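/- **Theorem 2.2 (anisotropic Heisenberg model).** Let $S\in\{\tfrac12,1,\tfrac32,\dots\}$ and $\beta>0$. On $\mathcal H_n=(\mathbb C^{2S+1})^{\otimes n}$ let $S_i^{(1)},S_i^{(2)},S_i^{(3)}$, $1\le i\le n$, be the usual spin-$S$ operators acting on the $i$-th factor, and for $\Delta\in[-1,1)$ let $$H_{n,\Delta}=-\frac2n\sum_{1\le i<j\le n}\bigl(S_i^{(1)}S_j^{(1)}+S_i^{(2)}S_j^{(2)}+\Delta\,S_i^{(3)}S_j^{(3)}\bigr),\qquad \langle A\rangle_{n,\beta,\Delta}=\frac{\operatorname{Tr}[A\,e^{-\beta H_{n,\Delta}}]}{\operatorname{Tr}[e^{-\beta H_{n,\Delta}}]} .$$ Let $\eta(x)=\log\dfrac{\sinh(\frac{2S+1}2x)}{\sinh(\frac12x)}$ for $x\in\mathbb R\setminus\{0\}$ and $\eta(0)=\log(2S+1)$; for $m\in(-S,S)$ let $x^\star(m)$ be the unique real solution of $\eta'(x)=m$; and let $$g_\beta(m)=\eta(x^\star(m))-m\,x^\star(m)+\beta m^2,\qquad m\in[0,S).$$ Then $g_\beta$ has a unique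 maximiser $m^\star(\beta)$ in $[0,S)$, and for every $\Delta\in[-1,1)$ and every $h\in\mathbb C$ $$\lim_{n\to\infty}\Bigl\langle\exp\Bigl\{\frac hn\sum_{i=1}^nS_i^{(1)}\Bigr\}\Bigr\rangle_{n,\beta,\Delta}=I_0\bigl(h\,m^\star(\beta)\bigr),\qquad I_0(z)=\sum_{k\ge0}\frac1{(k!)^2}\Bigl(\frac z2\Bigr)^{2k}.$$ -/

import Mathlib

open Filter Topology

noncomputable section

namespace SpinModel

/-! Throughout, the spin quantum number `S ∈ ½ℕ` is encoded by the natural number `N = 2 S`,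
so that the one-site space is `ℂ ^ (N + 1)`. -/

/-- The spin quantum number `S = N / 2`. -/
def spin (N : ℕ) : ℝ := (N : ℝ) / 2

/-- The eigenvalue `S - k` of the third spin operator on the `k`-th basis vector of
`ℂ ^ (N + 1)`, `k = 0, …, 2 S`. -/
def weight (N : ℕ) (k : Fin (N + 1)) : ℝ := spin N - (k : ℝ)

/-- The raising operator, `S⁺ |m⟩ = √(S (S + 1) - m (m + 1)) |m + 1⟩`, where `|m⟩` is the basis
vector of weight `m`. The entry in row `j` and column `k` is `⟨m_j, S⁺ m_k⟩`, which is non-zero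
only for `m_j = m_k + 1`, that is `j + 1 = k`. -/
def spinPlus (N : ℕ) : Matrix (Fin (N + 1)) (Fin (N + 1)) ℂ :=
  Matrix.of fun j k =>
    if (j : ℕ) + 1 = (k : ℕ) then
      ((Real.sqrt (spin N * (spin N + 1) - weight N k * (weight N k + 1)) : ℝ) : ℂ)
    else 0

/-- The lowering operator, the adjoint of the raising operator. -/
def spinMinus (N : ℕ) : Matrix (Fin (N + 1)) (Fin (N + 1)) ℂ :=
  (spinPlus N).conjTranspose

/-- The one-site spin operator `S⁽¹⁾ = (S⁺ + S⁻) / 2`. -/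
def spinOne (N : ℕ) : Matrix (Fin (N + 1)) (Fin (N + 1)) ℂ :=
  (1 / 2 : ℂ) • (spinPlus N + spinMinus N)

/-- The one-site spin operator `S⁽²⁾ = (S⁺ - S⁻) / (2 i)`. -/
def spinTwo (N : ℕ) : Matrix (Fin (N + 1)) (Fin (N + 1)) ℂ :=
  (1 / (2 * Complex.I) : ℂ) • (spinPlus N - spinMinus N)

/-- The one-site spin operator `S⁽³⁾`, diagonal with entries `S, S - 1, …, -S`. -/
def spinThree (N : ℕ) : Matrix (Fin (N + 1)) (Fin (N + 1)) ℂ :=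
  Matrix.diagonal fun k => ((weight N k : ℝ) : ℂ)

/-- Operators on `(ℂ ^ (N + 1)) ^ ⊗ n`, as matrices in the product basis, which is indexed by the
configurations `Fin n → Fin (N + 1)`. -/
abbrev Operator (N n : ℕ) : Type :=
  Matrix (Fin n → Fin (N + 1)) (Fin n → Fin (N + 1)) ℂ

/-- The operator `1 ⊗ ⋯ ⊗ A ⊗ ⋯ ⊗ 1` with the one-site operator `A` acting on site `i`. -/
def onSite {N n : ℕ} (i : Fin n) (A : Matrix (Fin (N + 1)) (Fin (N + 1)) ℂ) : Operator N n :=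
  Matrix.of fun σ τ => A (σ i) (τ i) * ∏ j ∈ Finset.univ.erase i, if σ j = τ j then 1 else 0

/-- The Hamiltonian
`-(2 / n) ∑_{i < j} (S_i⁽¹⁾ S_j⁽¹⁾ + S_i⁽²⁾ S_j⁽²⁾ + Δ S_i⁽³⁾ S_j⁽³⁾)` of the quantum Heisenberg
model of spin `S = N / 2` on the complete graph with `n` sites. -/
def heisenberg (N n : ℕ) (Δ : ℝ) : Operator N n :=
  (-(2 / (n : ℂ))) • ∑ i : Fin n, ∑ j ∈ Finset.Ioi i,
    (onSite i (spinOne N) * onSite j (spinOne N)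
      + onSite i (spinTwo N) * onSite j (spinTwo N)
      + (Δ : ℂ) • (onSite i (spinThree N) * onSite j (spinThree N)))

/-- The Gibbs state `⟨A⟩ = Tr (A exp (-β H)) / Tr (exp (-β H))` of the Heisenberg model. -/
def gibbs (N n : ℕ) (β Δ : ℝ) (A : Operator N n) : ℂ :=
  (A * NormedSpace.exp ((-(β : ℂ)) • heisenberg N n Δ)).trace
    / (NormedSpace.exp ((-(β : ℂ)) • heisenberg N n Δ)).trace

/-- `exp ((h / n) ∑_i S_i⁽¹⁾)`. -/
def expMagnetisation (N n : ℕ) (h : ℂ) : Operator N n :=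
  NormedSpace.exp ((h / (n : ℂ)) • ∑ i : Fin n, onSite i (spinOne N))

/-- `η(x) = log (sinh ((2 S + 1) x / 2) / sinh (x / 2))`, with `η(0) = log (2 S + 1)`. -/
def eta (N : ℕ) (x : ℝ) : ℝ :=
  if x = 0 then Real.log (2 * spin N + 1)
  else Real.log (Real.sinh ((2 * spin N + 1) / 2 * x) / Real.sinh (x / 2))

/-- `x⋆(m)`, the solution of `η'(x) = m`, which exists and is unique for `-S < m < S`. -/
def xStar (N : ℕ) (m : ℝ) : ℝ :=
  Classical.epsilon fun x : ℝ => deriv (eta N) x = m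

/-- `g_β(m) = η(x⋆(m)) - m x⋆(m) + β m²`, used for `0 ≤ m < S`. -/
def gFun (N : ℕ) (β m : ℝ) : ℝ :=
  eta N (xStar N m) - m * xStar N m + β * m ^ 2

/-- `m` is the unique maximiser of `g_β` on `[0, S)`. -/
def IsMaximiser (N : ℕ) (β m : ℝ) : Prop :=
  m ∈ Set.Ico 0 (spin N) ∧ ∀ m' ∈ Set.Ico 0 (spin N), m' ≠ m → gFun N β m' < gFun N β m

/-- The modified Bessel function `I₀(z) = ∑_{k ≥ 0} (z / 2) ^ (2 k) / (k!)²`. -/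
def besselI0 (z : ℂ) : ℂ :=
  ∑' k : ℕ, 1 / ((k.factorial : ℂ) ^ 2) * (z / 2) ^ (2 * k)

end SpinModel

end

namespace SpinModel

/-! ### Hyperbolic functions -/

/-! Write T₁, T₂, T₃ for the components of the total spin and x = T₁/n, y = T₂/n. As n grows, x and
y become asymptotically commuting, x² + y² concentrates at m⋆², and the Gibbs state is invariant
under rotations about the third axis. So (x, y) behaves like a uniform point on the circle of radius
m⋆, and the average of exp(h m⋆ cos θ) over θ is I₀(h m⋆).

Mean-field analysis. In the variable conjugate to m, the derivative of g_β has the sign of 2βη'(x) -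
x. This is strictly concave on [0, ∞) (`strictConcaveOn_magnetisation`), so it changes sign at most
once on (0, ∞), which gives the unique maximiser (`exists_isMaximiser`).

Concentration. Up to on-site terms bounded uniformly in n, which cost only bounded factors in
partition functions, -βH equals (β/n)(T₁² + T₂² + ΔT₃²). Put R = x² + y² - m⋆² and add tnR² to the
exponent. The Peierls-Bogoliubov inequality bounds tn⟨R²⟩ by the logarithm of the ratio of the
tilted to the original partition function. The latter is at least exp(n max g_β), up to a constant,
by Peierls' inequality in a product basis (`exp_le_trace_exp_collective`). For small t > 0 the gap 1
- Δ > 0 allows the tilted exponent to be dominated by a function of the Casimir operator alone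
(`tilted_posSemidef`). The trace of its exponential is controlled by counting highest-weight vectors
with η (`sum_exp_casimir_le`). The exponential rates agree up to an arbitrarily small error, whence
⟨R²⟩ → 0.

Moments. T₃ is conserved, so ⟨[T₃, x^(p+1) y]⟩ = 0. Expanding the commutator and replacing y² by m⋆²
- x² + R yields (p+2)⟨x^(p+2)⟩ = (p+1) m⋆² ⟨x^p⟩ + o(1), the recursion for the moments of m⋆ cos θ
(`tendsto_thermal_average_pow`). Since ‖x‖ is bounded uniformly in n, dominated convergence sums the
exponential series. -/

theorem sinh_lt_mul_cosh {t : ℝ} (ht : 0 < t) : Real.sinh t < t * Real.cosh t := by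
  have hd : ∀ x : ℝ, HasDerivAt (fun x => x * Real.cosh x - Real.sinh x) (x * Real.sinh x) x := by
    intro x
    convert! ((hasDerivAt_id x).mul (Real.hasDerivAt_cosh x)).sub (Real.hasDerivAt_sinh x) using 1
    simp
  have hmono : StrictMonoOn (fun x => x * Real.cosh x - Real.sinh x) (Set.Ici 0) := by
    refine strictMonoOn_of_deriv_pos (convex_Ici 0) (by fun_prop) fun x hx => ?_
    rw [interior_Ici] at hx
    rw [(hd x).deriv]
    exact mul_pos hx (Real.sinh_pos_iff.2 hx)
  have := hmono (Set.self_mem_Ici) (Set.mem_Ici.2 ht.le) ht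
  simp at this
  linarith

/-- The difference of the two sides vanishes at 0 and has derivative 4 sinh x (x cosh x - sinh x),
which is positive by `sinh_lt_mul_cosh`. -/
theorem three_mul_sinh_mul_cosh_lt {t : ℝ} (ht : 0 < t) :
    3 * Real.sinh t * Real.cosh t < t * (3 * Real.cosh t ^ 2 - Real.sinh t ^ 2) := by
  have hd : ∀ x : ℝ, HasDerivAt
      (fun x => x * (3 * Real.cosh x ^ 2 - Real.sinh x ^ 2) - 3 * Real.sinh x * Real.cosh x)
      (4 * Real.sinh x * (x * Real.cosh x - Real.sinh x)) x := by
    intro x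
    convert! ((hasDerivAt_id x).mul ((((Real.hasDerivAt_cosh x).pow 2).const_mul 3).sub
      ((Real.hasDerivAt_sinh x).pow 2))).sub
      (((Real.hasDerivAt_sinh x).const_mul 3).mul (Real.hasDerivAt_cosh x)) using 1
    simp
    ring
  have hmono : StrictMonoOn
      (fun x => x * (3 * Real.cosh x ^ 2 - Real.sinh x ^ 2) - 3 * Real.sinh x * Real.cosh x)
      (Set.Ici 0) := by
    refine strictMonoOn_of_deriv_pos (convex_Ici 0) (by fun_prop) fun x hx => ?_
    rw [interior_Ici] at hx
    rw [(hd x).deriv]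
    have h1 : 0 < Real.sinh x := Real.sinh_pos_iff.2 hx
    have h2 := sinh_lt_mul_cosh hx
    have h3 : 0 < x * Real.cosh x - Real.sinh x := by linarith
    positivity
  have := hmono (Set.self_mem_Ici) (Set.mem_Ici.2 ht.le) ht
  simp at this
  linarith

/-- The numerator of the derivative is -t² sinh² t times the quantity shown positive in
`three_mul_sinh_mul_cosh_lt`. This monotonicity is what makes η''' negative on (0, ∞). -/
theorem strictAntiOn_cube_mul_cosh_div_sinh_cube :
    StrictAntiOn (fun t : ℝ => t ^ 3 * Real.cosh t / Real.sinh t ^ 3) (Set.Ioi 0) := by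
  have hs : ∀ x ∈ Set.Ioi (0 : ℝ), Real.sinh x ≠ 0 := fun x hx => (Real.sinh_pos_iff.2 hx).ne'
  refine strictAntiOn_of_deriv_neg (convex_Ioi 0) ?_ fun x hx => ?_
  · exact ContinuousOn.div (by fun_prop) (by fun_prop) fun x hx => pow_ne_zero 3 (hs x hx)
  · rw [interior_Ioi] at hx
    have hd := (((hasDerivAt_id x).pow 3).mul (Real.hasDerivAt_cosh x)).div
      ((Real.hasDerivAt_sinh x).pow 3) (pow_ne_zero 3 (hs x hx))
    have hd' := hd.deriv
    simp only [id] at hd'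
    have hfun : (fun t : ℝ => t ^ 3 * Real.cosh t / Real.sinh t ^ 3) =
      ((id ^ 3 * Real.cosh) / (Real.sinh ^ 3)) := by ext; simp
    rw [hfun, hd']
    have h1 : 0 < Real.sinh x := Real.sinh_pos_iff.2 hx
    have h2 := three_mul_sinh_mul_cosh_lt hx
    have h3 : (0 : ℝ) < x := hx
    apply div_neg_of_neg_of_pos _ (by simp only [Pi.pow_apply]; positivity)
    have h4 : 0 < x ^ 2 * Real.sinh x ^ 2 *
      (x * (3 * Real.cosh x ^ 2 - Real.sinh x ^ 2) - 3 * Real.sinh x * Real.cosh x) := by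
      have : 0 < x * (3 * Real.cosh x ^ 2 - Real.sinh x ^ 2) - 3 * Real.sinh x * Real.cosh x := by
        linarith
      positivity
    simp
    nlinarith [h4]

/-! ### The function `η` -/

/-- The weighted exponential sum `∑_k w_k ^ p exp (w_k x)`. -/
noncomputable def weightSum (N p : ℕ) (x : ℝ) : ℝ :=
  ∑ k : Fin (N + 1), weight N k ^ p * Real.exp (weight N k * x)

theorem weightSum_zero_pos (N : ℕ) (x : ℝ) : 0 < weightSum N 0 x := by
  unfold weightSum
  exact Finset.sum_pos (fun k _ => by positivity) Finset.univ_nonempty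

theorem hasDerivAt_weightSum (N p : ℕ) (x : ℝ) :
    HasDerivAt (weightSum N p) (weightSum N (p + 1) x) x := by
  unfold weightSum
  refine HasDerivAt.fun_sum fun k _ => ?_
  have := ((hasDerivAt_id x).const_mul (weight N k)).exp.const_mul (weight N k ^ p)
  refine this.congr_deriv ?_
  simp only [id]
  ring

/-- The factor exp(x/2) - exp(-x/2) makes the geometric sum telescope. Hence η is the logarithm of
the one-site partition function, and the case distinction at 0 disappears. -/
theorem weightSum_mul_sinh (N : ℕ) (x : ℝ) :
    weightSum N 0 x * Real.sinh (x / 2) = Real.sinh ((2 * spin N + 1) / 2 * x) := by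
  have h : ∀ k : ℕ, Real.exp ((spin N - k) * x) * (Real.exp (x / 2) - Real.exp (-(x / 2))) =
      Real.exp ((spin N + 1 / 2 - k) * x) - Real.exp ((spin N + 1 / 2 - (k + 1 : ℕ)) * x) := by
    intro k
    rw [mul_sub, ← Real.exp_add, ← Real.exp_add]
    push_cast
    ring_nf
  unfold weightSum weight
  simp only [pow_zero, one_mul]
  rw [Fin.sum_univ_eq_sum_range (fun k : ℕ => Real.exp ((spin N - k) * x)), Real.sinh_eq,
    Real.sinh_eq, mul_div_assoc', Finset.sum_mul, Finset.sum_congr rfl fun k _ => h k,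
    Finset.sum_range_sub' (fun k : ℕ => Real.exp ((spin N + 1 / 2 - k) * x))]
  unfold spin
  push_cast
  ring_nf

theorem eta_eq_log (N : ℕ) (x : ℝ) : eta N x = Real.log (weightSum N 0 x) := by
  unfold eta
  split_ifs with h
  · subst h
    simp [weightSum, spin]
    ring_nf
  · rw [← weightSum_mul_sinh, mul_div_assoc, div_self, mul_one]
    rw [Ne, Real.sinh_eq_zero]
    simpa using h

theorem exp_eta (N : ℕ) (x : ℝ) : Real.exp (eta N x) = weightSum N 0 x := by
  rw [eta_eq_log, Real.exp_log (weightSum_zero_pos N x)]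

/-- The derivative of `η`. -/
noncomputable def magnetisation (N : ℕ) (x : ℝ) : ℝ := weightSum N 1 x / weightSum N 0 x

theorem hasDerivAt_eta (N : ℕ) (x : ℝ) : HasDerivAt (eta N) (magnetisation N x) x := by
  rw [show eta N = fun x => Real.log (weightSum N 0 x) from funext (eta_eq_log N)]
  exact (hasDerivAt_weightSum N 0 x).log (weightSum_zero_pos N x).ne'

theorem hasDerivAt_magnetisation (N : ℕ) (x : ℝ) :
    HasDerivAt (magnetisation N)
      ((weightSum N 2 x * weightSum N 0 x - weightSum N 1 x * weightSum N 1 x)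
        / weightSum N 0 x ^ 2) x :=
  (hasDerivAt_weightSum N 1 x).div (hasDerivAt_weightSum N 0 x) (weightSum_zero_pos N x).ne'

theorem continuous_magnetisation (N : ℕ) : Continuous (magnetisation N) :=
  continuous_iff_continuousAt.2 fun x => (hasDerivAt_magnetisation N x).continuousAt

/-- The derivative is the variance of the weight under the tilted measure. Written as a symmetrised
double sum over pairs, it is positive because the two extreme weights differ by N ≥ 1. -/
theorem deriv_magnetisation_pos {N : ℕ} (hN : 1 ≤ N) (x : ℝ) : 0 < deriv (magnetisation N) x := by
  rw [(hasDerivAt_magnetisation N x).deriv]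
  refine div_pos ?_ (pow_pos (weightSum_zero_pos N x) 2)
  have h : 2 * (weightSum N 2 x * weightSum N 0 x - weightSum N 1 x * weightSum N 1 x) =
      ∑ j : Fin (N + 1), ∑ k : Fin (N + 1), (weight N j - weight N k) ^ 2 *
        (Real.exp (weight N j * x) * Real.exp (weight N k * x)) := by
    have : ∀ j k : Fin (N + 1), (weight N j - weight N k) ^ 2 *
        (Real.exp (weight N j * x) * Real.exp (weight N k * x)) =
        weight N j ^ 2 * Real.exp (weight N j * x) * (weight N k ^ 0 * Real.exp (weight N k * x))
        + weight N j ^ 0 * Real.exp (weight N j * x) * (weight N k ^ 2 * Real.exp (weight N k * x))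
        - 2 * (weight N j ^ 1 * Real.exp (weight N j * x) *
          (weight N k ^ 1 * Real.exp (weight N k * x))) := by
      intro j k; ring
    simp only [this, Finset.sum_add_distrib, Finset.sum_sub_distrib, ← Finset.mul_sum,
      ← Finset.sum_mul, weightSum]
    ring
  have hpos : 0 < ∑ j : Fin (N + 1), ∑ k : Fin (N + 1), (weight N j - weight N k) ^ 2 *
        (Real.exp (weight N j * x) * Real.exp (weight N k * x)) := by
    refine Finset.sum_pos' (fun j _ => Finset.sum_nonneg fun k _ => by positivity)
      ⟨0, Finset.mem_univ _, Finset.sum_pos' (fun k _ => by positivity)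
        ⟨Fin.last N, Finset.mem_univ _, ?_⟩⟩
    have : (weight N 0 - weight N (Fin.last N)) = N := by simp [weight]
    rw [this]
    have : (0 : ℝ) < N := by exact_mod_cast hN
    positivity
  linarith

theorem strictMono_magnetisation {N : ℕ} (hN : 1 ≤ N) : StrictMono (magnetisation N) :=
  strictMono_of_deriv_pos (deriv_magnetisation_pos hN)

/-- The reversal k ↦ N - k changes the sign of every weight. -/
theorem magnetisation_zero (N : ℕ) : magnetisation N 0 = 0 := by
  unfold magnetisation
  rw [div_eq_zero_iff]
  left
  have h : weightSum N 1 0 = -weightSum N 1 0 := by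
    unfold weightSum
    rw [← Finset.sum_neg_distrib, ← Equiv.sum_comp Fin.revPerm]
    refine Finset.sum_congr rfl fun k _ => ?_
    simp [weight, spin, Fin.val_rev]
    rw [Nat.cast_sub (by omega)]
    ring
  linarith

theorem spin_sub_magnetisation (N : ℕ) (x : ℝ) :
    spin N - magnetisation N x =
      (∑ k : Fin (N + 1), (k : ℝ) * Real.exp (weight N k * x)) / weightSum N 0 x := by
  rw [eq_div_iff (weightSum_zero_pos N x).ne', sub_mul, magnetisation,
    div_mul_cancel₀ _ (weightSum_zero_pos N x).ne']
  unfold weightSum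
  rw [Finset.mul_sum, ← Finset.sum_sub_distrib]
  refine Finset.sum_congr rfl fun k _ => ?_
  unfold weight
  ring

theorem magnetisation_lt_spin {N : ℕ} (hN : 1 ≤ N) (x : ℝ) : magnetisation N x < spin N := by
  have h := spin_sub_magnetisation N x
  have : 0 < (∑ k : Fin (N + 1), (k : ℝ) * Real.exp (weight N k * x)) / weightSum N 0 x := by
    refine div_pos (Finset.sum_pos' (fun k _ => by positivity) ⟨Fin.last N, Finset.mem_univ _, ?_⟩)
      (weightSum_zero_pos N x)
    have : (0 : ℝ) < N := by exact_mod_cast hN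
    simp only [Fin.val_last]
    positivity
  linarith

theorem tendsto_magnetisation (N : ℕ) : Tendsto (magnetisation N) atTop (𝓝 (spin N)) := by
  have hlim : Tendsto (fun x : ℝ => (∑ k : Fin (N + 1), (k : ℝ)) * Real.exp (-x)) atTop (𝓝 0) := by
    simpa using Real.tendsto_exp_neg_atTop_nhds_zero.const_mul (∑ k : Fin (N + 1), (k : ℝ))
  have h0 : Tendsto (fun x => spin N - magnetisation N x) atTop (𝓝 0) := by
    refine squeeze_zero' (Eventually.of_forall fun x => ?_) ?_ hlim
    · rw [spin_sub_magnetisation]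
      exact div_nonneg (Finset.sum_nonneg fun k _ => by positivity) (weightSum_zero_pos N x).le
    · filter_upwards [eventually_ge_atTop 0] with x hx
      rw [spin_sub_magnetisation, div_le_iff₀ (weightSum_zero_pos N x)]
      -- The top weight k = 0 bounds the denominator from below. It drops out of the numerator,
      -- where every remaining term is smaller than it by a factor of at least exp(-x).
      have hZ : Real.exp (spin N * x) ≤ weightSum N 0 x := by
        unfold weightSum
        have := Finset.single_le_sum (f := fun k : Fin (N + 1) =>
          weight N k ^ 0 * Real.exp (weight N k * x)) (fun k _ => by positivity)
          (Finset.mem_univ 0)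
        simpa [weight] using this
      calc ∑ k : Fin (N + 1), (k : ℝ) * Real.exp (weight N k * x)
          ≤ ∑ k : Fin (N + 1), (k : ℝ) * (Real.exp (-x) * Real.exp (spin N * x)) := by
            refine Finset.sum_le_sum fun k _ => ?_
            rcases Nat.eq_zero_or_pos (k : ℕ) with h | h
            · simp [h]
            · refine mul_le_mul_of_nonneg_left ?_ (by positivity)
              rw [← Real.exp_add, Real.exp_le_exp]
              unfold weight
              have : (1 : ℝ) ≤ (k : ℕ) := by exact_mod_cast h
              nlinarith
        _ = (∑ k : Fin (N + 1), (k : ℝ)) * Real.exp (-x) * Real.exp (spin N * x) := by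
            rw [← Finset.sum_mul]; ring
        _ ≤ _ := by gcongr
  have := (tendsto_const_nhds (x := spin N)).sub h0
  simpa using this

theorem magnetisation_eq_coth {N : ℕ} {x : ℝ} (hx : 0 < x) :
    magnetisation N x = (2 * spin N + 1) / 2 *
      (Real.cosh ((2 * spin N + 1) / 2 * x) / Real.sinh ((2 * spin N + 1) / 2 * x))
      - 1 / 2 * (Real.cosh (x / 2) / Real.sinh (x / 2)) := by
  set M := (2 * spin N + 1) / 2 with hM
  have hMpos : 0 < M := by unfold spin at hM; rw [hM]; positivity
  have h1 : 0 < Real.sinh (M * x) := Real.sinh_pos_iff.2 (by positivity)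
  have h2 : 0 < Real.sinh (x / 2) := Real.sinh_pos_iff.2 (by positivity)
  have hd1 : HasDerivAt (fun x => Real.log (Real.sinh (M * x)) - Real.log (Real.sinh (x / 2)))
      (Real.cosh (M * x) * M / Real.sinh (M * x) -
        Real.cosh (x / 2) * (1 / 2) / Real.sinh (x / 2)) x := by
    have a := ((hasDerivAt_id x).const_mul M).sinh.log (by simpa using h1.ne')
    have b := ((hasDerivAt_id x).div_const 2).sinh.log (by simpa using h2.ne')
    simpa using! a.sub b
  have he : eta N =ᶠ[𝓝 x]
      fun x => Real.log (Real.sinh (M * x)) - Real.log (Real.sinh (x / 2)) := by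
    filter_upwards [lt_mem_nhds hx] with y hy
    have h1 : 0 < Real.sinh (M * y) := Real.sinh_pos_iff.2 (by positivity)
    have h2 : 0 < Real.sinh (y / 2) := Real.sinh_pos_iff.2 (by positivity)
    rw [eta, if_neg hy.ne', Real.log_div h1.ne' h2.ne']
  rw [(hasDerivAt_eta N x).unique (hd1.congr_of_eventuallyEq he)]
  ring

theorem hasDerivAt_coth {x : ℝ} (hx : x ≠ 0) :
    HasDerivAt (fun x => Real.cosh x / Real.sinh x) (-(1 / Real.sinh x ^ 2)) x := by
  have hs : Real.sinh x ≠ 0 := by rwa [Ne, Real.sinh_eq_zero]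
  refine ((Real.hasDerivAt_cosh x).div (Real.hasDerivAt_sinh x) hs).congr_deriv ?_
  have := Real.cosh_sq x
  field_simp
  linarith

/-- With φ(t) = t³ cosh t / sinh³ t and M = S + 1/2, the coth formula gives second derivative
(2/x³)(φ(Mx) - φ(x/2)). It is negative because φ decreases and M > 1/2. -/
theorem strictConcaveOn_magnetisation {N : ℕ} (hN : 1 ≤ N) :
    StrictConcaveOn ℝ (Set.Ici 0) (magnetisation N) := by
  refine StrictAntiOn.strictConcaveOn_of_deriv (convex_Ici 0)
    (continuous_magnetisation N).continuousOn ?_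
  rw [interior_Ici]
  set M := (2 * spin N + 1) / 2 with hM
  have hMlt : 1 / 2 < M := by
    have : (1 : ℝ) ≤ N := by exact_mod_cast hN
    unfold spin at hM
    linarith
  have hMpos : 0 < M := by linarith
  have hderiv : Set.EqOn (fun x => M ^ 2 * (-(1 / Real.sinh (M * x) ^ 2))
      - 1 / 4 * (-(1 / Real.sinh (x / 2) ^ 2))) (deriv (magnetisation N)) (Set.Ioi 0) := by
    intro x hx
    have hx' : (0 : ℝ) < x := hx
    have he : magnetisation N =ᶠ[𝓝 x] fun x => M * (Real.cosh (M * x) / Real.sinh (M * x))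
        - 1 / 2 * (Real.cosh (x / 2) / Real.sinh (x / 2)) := by
      filter_upwards [lt_mem_nhds hx'] with y hy
      exact magnetisation_eq_coth hy
    rw [he.deriv_eq]
    have a := ((hasDerivAt_coth (x := M * x) (by positivity)).comp x
      ((hasDerivAt_id x).const_mul M)).const_mul M
    have b := ((hasDerivAt_coth (x := x / 2) (by positivity)).comp x
      ((hasDerivAt_id x).div_const 2)).const_mul (1 / 2)
    have c := (a.sub b).deriv
    refine Eq.trans ?_ c.symm
    simp only
    ring
  refine StrictAntiOn.congr ?_ hderiv
  refine strictAntiOn_of_deriv_neg (convex_Ioi 0) ?_ fun x hx => ?_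
  · refine ContinuousOn.sub (ContinuousOn.mul continuousOn_const (ContinuousOn.neg
      (ContinuousOn.div (by fun_prop) (by fun_prop) ?_))) (ContinuousOn.mul continuousOn_const
      (ContinuousOn.neg (ContinuousOn.div (by fun_prop) (by fun_prop) ?_)))
    · intro x hx
      have : 0 < Real.sinh (M * x) := Real.sinh_pos_iff.2 (mul_pos hMpos hx)
      positivity
    · intro x hx
      have : 0 < Real.sinh (x / 2) := Real.sinh_pos_iff.2 (half_pos hx)
      positivity
  · rw [interior_Ioi] at hx
    have hx' : (0 : ℝ) < x := hx
    have h1 : 0 < Real.sinh (M * x) := Real.sinh_pos_iff.2 (mul_pos hMpos hx)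
    have h2 : 0 < Real.sinh (x / 2) := Real.sinh_pos_iff.2 (half_pos hx)
    have a := (((((hasDerivAt_id x).const_mul M).sinh.pow 2).inv
      (by simpa using h1.ne')).neg.const_mul (M ^ 2))
    have b := (((((hasDerivAt_id x).div_const 2).sinh.pow 2).inv
      (by simpa using h2.ne')).neg.const_mul (1 / 4))
    have c := (a.sub b).deriv
    have hq := strictAntiOn_cube_mul_cosh_div_sinh_cube (half_pos hx') (mul_pos hMpos hx')
      (by nlinarith : x / 2 < M * x)
    have hfin : deriv (fun x => M ^ 2 * (-(1 / Real.sinh (M * x) ^ 2))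
      - 1 / 4 * (-(1 / Real.sinh (x / 2) ^ 2))) x = 2 / x ^ 3 *
        ((M * x) ^ 3 * Real.cosh (M * x) / Real.sinh (M * x) ^ 3 -
        (x / 2) ^ 3 * Real.cosh (x / 2) / Real.sinh (x / 2) ^ 3) := by
      refine Eq.trans ?_ (c.trans ?_)
      · congr 1
        ext y
        simp
      · simp
        field_simp
        ring
    rw [hfin]
    exact mul_neg_of_pos_of_neg (by positivity) (by simpa using sub_neg.2 hq)

/-! ### Legendre duality and the mean-field maximiser. -/

theorem xStar_magnetisation {N : ℕ} (hN : 1 ≤ N) (x : ℝ) : xStar N (magnetisation N x) = x := by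
  have h : deriv (eta N) (xStar N (magnetisation N x)) = magnetisation N x :=
    Classical.epsilon_spec (p := fun y => deriv (eta N) y = magnetisation N x)
      ⟨x, (hasDerivAt_eta N x).deriv⟩
  rw [(hasDerivAt_eta N _).deriv] at h
  exact (strictMono_magnetisation hN).injective h

theorem exists_magnetisation_eq {N : ℕ} {r : ℝ} (h0 : 0 ≤ r) (hr : r < spin N) :
    ∃ x, 0 ≤ x ∧ magnetisation N x = r := by
  obtain ⟨b, hb, hb0⟩ := (((tendsto_magnetisation N).eventually_const_lt hr).and
    (eventually_ge_atTop 0)).exists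
  obtain ⟨x, hx, hxr⟩ := intermediate_value_Icc hb0 (continuous_magnetisation N).continuousOn
    (show r ∈ Set.Icc _ _ from ⟨by rwa [magnetisation_zero], hb.le⟩)
  exact ⟨x, hx.1, hxr⟩

/-- `g_β` in terms of the conjugate variable, `g_β(η'(x))`. -/
noncomputable def gDual (N : ℕ) (β x : ℝ) : ℝ :=
  eta N x - magnetisation N x * x + β * magnetisation N x ^ 2

theorem gFun_magnetisation {N : ℕ} (hN : 1 ≤ N) (β x : ℝ) :
    gFun N β (magnetisation N x) = gDual N β x := by
  rw [gFun, xStar_magnetisation hN, gDual]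

/-- The two terms η'(x) cancel, as always for a Legendre transform, so monotonicity is read off from
the mean-field equation. -/
theorem hasDerivAt_gDual {N : ℕ} (β x : ℝ) : HasDerivAt (gDual N β)
    (deriv (magnetisation N) x * (2 * β * magnetisation N x - x)) x := by
  have hm := (hasDerivAt_magnetisation N x).differentiableAt.hasDerivAt
  refine (((hasDerivAt_eta N x).sub (hm.mul (hasDerivAt_id x))).add
    ((hm.pow 2).const_mul β)).congr_deriv ?_
  simp
  ring

theorem continuous_gDual (N : ℕ) (β : ℝ) : Continuous (gDual N β) :=
  continuous_iff_continuousAt.2 fun x => (hasDerivAt_gDual β x).continuousAt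

/-- The mean-field equation `x = 2 β η'(x)` has a largest non-negative solution, at which the
difference of both sides changes sign. -/
theorem exists_meanField_solution {N : ℕ} (hN : 1 ≤ N) {β : ℝ} (hβ : 0 < β) :
    ∃ x₀, 0 ≤ x₀ ∧ 2 * β * magnetisation N x₀ = x₀ ∧
      (∀ x, 0 < x → x < x₀ → 0 < 2 * β * magnetisation N x - x) ∧
      (∀ x, x₀ < x → 2 * β * magnetisation N x - x < 0) := by
  set φ : ℝ → ℝ := fun x => 2 * β * magnetisation N x - x with hφ
  have hconc : StrictConcaveOn ℝ (Set.Ici 0) φ := by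
    refine ⟨convex_Ici 0, fun x hx y hy hxy a b ha hb hab => ?_⟩
    have := (strictConcaveOn_magnetisation hN).2 hx hy hxy ha hb hab
    simp only [smul_eq_mul, hφ] at this ⊢
    nlinarith [mul_lt_mul_of_pos_left this (by positivity : 0 < 2 * β)]
  have hφ0 : φ 0 = 0 := by simp [hφ, magnetisation_zero]
  have hcont : Continuous φ := ((continuous_magnetisation N).const_mul _).sub continuous_id
  by_cases hneg : ∀ x, 0 < x → φ x < 0
  · exact ⟨0, le_rfl, by simp [magnetisation_zero], fun x h h' => absurd h' h.not_gt, hneg⟩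
  · push Not at hneg
    obtain ⟨x₁, hx₁, hφ₁⟩ := hneg
    have hx₁' : x₁ ≤ 2 * β * spin N := by
      have := mul_lt_mul_of_pos_left (magnetisation_lt_spin hN x₁) (by positivity : 0 < 2 * β)
      simp only [hφ] at hφ₁
      linarith
    -- Because η' < S, no solution lies beyond 2βS, so the intermediate value theorem applies
    -- between x₁ and this point.
    have hend : φ (2 * β * spin N) ≤ 0 := by
      have := mul_lt_mul_of_pos_left (magnetisation_lt_spin hN (2 * β * spin N))
        (by positivity : 0 < 2 * β)
      simp only [hφ]
      linarith
    obtain ⟨x₀, hx₀, h₀⟩ := intermediate_value_Icc' hx₁' hcont.continuousOn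
      (show (0 : ℝ) ∈ Set.Icc _ _ from ⟨hend, hφ₁⟩)
    have hpos : 0 < x₀ := hx₁.trans_le hx₀.1
    refine ⟨x₀, hpos.le, by simp only [hφ] at h₀; linarith, fun x hx hxx => ?_, fun x hxx => ?_⟩
    · have := hconc.lt_on_openSegment (Set.self_mem_Ici) (Set.mem_Ici.2 hpos.le) hpos.ne
        (z := x) (by rw [openSegment_eq_Ioo hpos]; exact ⟨hx, hxx⟩)
      rwa [hφ0, h₀, min_self] at this
    -- If φ(x) were non-negative beyond x₀, strict concavity between 0 and x would force φ(x₀) > 0.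
    · by_contra! hcon
      have hx : 0 < x := hpos.trans hxx
      have := hconc.lt_on_openSegment (Set.self_mem_Ici) (Set.mem_Ici.2 hx.le) hx.ne
        (z := x₀) (by rw [openSegment_eq_Ioo hx]; exact ⟨hpos, hxx⟩)
      rw [hφ0, h₀] at this
      exact (min_eq_left (show 0 ≤ φ x from hcon) ▸ this).false

/-- The unique maximiser of `g_β`, the value of the maximum, and a quantitative separation of
`g_β`, in its upper semicontinuous extension to `[0, S]`, from the maximum. -/
theorem exists_isMaximiser {N : ℕ} (hN : 1 ≤ N) {β : ℝ} (hβ : 0 < β) :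
    ∃ m, IsMaximiser N β m ∧
      (∀ r, 0 ≤ r → r ≤ spin N → ∃ x, 0 ≤ x ∧
        eta N x - x * r + β * r ^ 2 ≤ eta N (2 * β * m) - β * m ^ 2) ∧
      ∀ ε, 0 < ε → ∃ δ, 0 < δ ∧ ∀ r, 0 ≤ r → r ≤ spin N → ε ≤ |r ^ 2 - m ^ 2| →
        ∃ x, 0 ≤ x ∧ eta N x - x * r + β * r ^ 2 ≤ eta N (2 * β * m) - β * m ^ 2 - δ := by
  obtain ⟨x₀, hx₀, heq, hlt, hgt⟩ := exists_meanField_solution hN hβ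
  set m := magnetisation N x₀ with hm
  have hmono : StrictMonoOn (gDual N β) (Set.Icc 0 x₀) := by
    refine strictMonoOn_of_deriv_pos (convex_Icc _ _) (continuous_gDual N β).continuousOn
      fun x hx => ?_
    rw [interior_Icc] at hx
    rw [(hasDerivAt_gDual β x).deriv]
    exact mul_pos (deriv_magnetisation_pos hN x) (hlt x hx.1 hx.2)
  have hanti : StrictAntiOn (gDual N β) (Set.Ici x₀) := by
    refine strictAntiOn_of_deriv_neg (convex_Ici _) (continuous_gDual N β).continuousOn
      fun x hx => ?_
    rw [interior_Ici] at hx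
    rw [(hasDerivAt_gDual β x).deriv]
    exact mul_neg_of_pos_of_neg (deriv_magnetisation_pos hN x) (hgt x hx)
  have hmax : ∀ x, 0 ≤ x → x ≠ x₀ → gDual N β x < gDual N β x₀ := by
    intro x hx hne
    rcases lt_or_gt_of_ne hne with h | h
    · exact hmono ⟨hx, h.le⟩ ⟨hx₀, le_rfl⟩ h
    · exact hanti Set.self_mem_Ici (Set.mem_Ici.2 h.le) h
  have hval : gDual N β x₀ = eta N (2 * β * m) - β * m ^ 2 := by
    rw [gDual, heq, ← hm]
    nth_rw 2 [← heq]
    ring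
  have hm0 : 0 ≤ m := by
    rw [hm, ← magnetisation_zero N]
    exact (strictMono_magnetisation hN).monotone hx₀
  -- For r < S the witness is the conjugate point x⋆(r). At r = S there is none, and a large x is
  -- used instead.
  have hpt : ∀ r, 0 ≤ r → r ≤ spin N → r ≠ m →
      ∃ x, 0 ≤ x ∧ eta N x - x * r + β * r ^ 2 < gDual N β x₀ := by
    intro r hr hrS hrm
    rcases hrS.lt_or_eq with h | h
    · obtain ⟨x, hx, hxr⟩ := exists_magnetisation_eq hr h
      refine ⟨x, hx, ?_⟩
      have := hmax x hx (by rintro rfl; exact hrm hxr.symm)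
      rw [gDual, hxr] at this
      linarith
    · subst h
      have h1 : gDual N β (x₀ + 1) < gDual N β x₀ := hmax _ (by linarith) (by linarith)
      -- Replacing η'(x) by S in `gDual` raises the value by at most β(S² - η'(x)²) ≤ 2βS(S -
      -- η'(x)). For large x this is less than the gap between the maximum and the value at x₀ + 1.
      have hlim : Tendsto (fun x => 2 * β * spin N * (spin N - magnetisation N x)) atTop (𝓝 0) := by
        simpa using ((tendsto_const_nhds (x := spin N)).sub
          (tendsto_magnetisation N)).const_mul (2 * β * spin N)
      obtain ⟨x, hx, hx1⟩ := ((hlim.eventually_lt_const (sub_pos.2 h1)).and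
        (eventually_ge_atTop (x₀ + 1))).exists
      have hx0 : 0 ≤ x := by linarith
      refine ⟨x, hx0, ?_⟩
      have h2 : gDual N β x ≤ gDual N β (x₀ + 1) :=
        hanti.antitoneOn (Set.mem_Ici.2 (by linarith)) (Set.mem_Ici.2 (by linarith)) hx1
      rw [gDual] at h2
      have h3 := magnetisation_lt_spin hN x
      nlinarith [mul_nonneg hx0 (sub_pos.2 h3).le,
        mul_nonneg hβ.le (sq_nonneg (spin N - magnetisation N x))]
  refine ⟨m, ⟨⟨hm0, magnetisation_lt_spin hN x₀⟩, fun m' hm' hne => ?_⟩, fun r hr hrS => ?_,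
    fun ε hε => ?_⟩
  · obtain ⟨x, hx, rfl⟩ := exists_magnetisation_eq hm'.1 hm'.2
    rw [hm, gFun_magnetisation hN, gFun_magnetisation hN]
    exact hmax x hx (by rintro rfl; exact hne rfl)
  · by_cases hrm : r = m
    · refine ⟨x₀, hx₀, ?_⟩
      rw [hrm, ← hval, gDual]
      linarith
    · obtain ⟨x, hx, h⟩ := hpt r hr hrS hrm
      exact ⟨x, hx, by rw [← hval]; exact h.le⟩
  -- For fixed x the bound is continuous in r, so a witness at one point works nearby with a fixed
  -- loss. Compactness makes the gap δ uniform.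
  · have hK : IsCompact (Set.Icc 0 (spin N) ∩ {r | ε ≤ |r ^ 2 - m ^ 2|}) :=
      isCompact_Icc.inter_right (isClosed_le continuous_const (by fun_prop))
    have key : ∃ δ, 0 < δ ∧ ∀ r ∈ Set.Icc 0 (spin N) ∩ {r | ε ≤ |r ^ 2 - m ^ 2|},
        ∃ x, 0 ≤ x ∧ eta N x - x * r + β * r ^ 2 ≤ gDual N β x₀ - δ := by
      refine hK.induction_on (p := fun s => ∃ δ, 0 < δ ∧ ∀ r ∈ s,
        ∃ x, 0 ≤ x ∧ eta N x - x * r + β * r ^ 2 ≤ gDual N β x₀ - δ)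
        ⟨1, one_pos, by simp⟩ ?_ ?_ ?_
      · rintro s t hst ⟨δ, hδ, h⟩
        exact ⟨δ, hδ, fun r hr => h r (hst hr)⟩
      · rintro s t ⟨δ, hδ, h⟩ ⟨δ', hδ', h'⟩
        refine ⟨min δ δ', lt_min hδ hδ', ?_⟩
        rintro r (hr | hr)
        · obtain ⟨x, hx, hxr⟩ := h r hr
          exact ⟨x, hx, hxr.trans (by linarith [min_le_left δ δ'])⟩
        · obtain ⟨x, hx, hxr⟩ := h' r hr
          exact ⟨x, hx, hxr.trans (by linarith [min_le_right δ δ'])⟩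
      · rintro r ⟨⟨hr, hrS⟩, hrε⟩
        have hrm : r ≠ m := by
          rintro rfl
          simp at hrε
          linarith
        obtain ⟨x, hx, h⟩ := hpt r hr hrS hrm
        obtain ⟨c, hc1, hc2⟩ := exists_between h
        have hcont : Continuous fun r : ℝ => eta N x - x * r + β * r ^ 2 := by fun_prop
        refine ⟨_, mem_nhdsWithin_of_mem_nhds (hcont.continuousAt.eventually_lt_const hc1),
          gDual N β x₀ - c, sub_pos.2 hc2, fun r' hr' => ⟨x, hx, ?_⟩⟩
        have : eta N x - x * r' + β * r' ^ 2 < c := hr'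
        linarith
    obtain ⟨δ, hδ, h⟩ := key
    exact ⟨δ, hδ, fun r hr hrS hrε => by rw [← hval]; exact h r ⟨⟨hr, hrS⟩, hrε⟩⟩

/-! ### Thermal states of matrices -/

section Matrices

open Matrix
open scoped Matrix.Norms.L2Operator ComplexOrder

variable {ι : Type*} [Fintype ι] [DecidableEq ι]

theorem exists_unitary_diagonal {B : Matrix ι ι ℂ} (hB : B.IsHermitian) :
    ∃ U ∈ unitaryGroup ι ℂ, ∃ b : ι → ℝ, B = U * diagonal (fun k => (b k : ℂ)) * Uᴴ := by
  refine ⟨hB.eigenvectorUnitary, hB.eigenvectorUnitary.2, hB.eigenvalues, ?_⟩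
  have h := hB.spectral_theorem
  rw [Unitary.conjStarAlgAut_apply] at h
  exact h

theorem exp_unitary_conj {U : Matrix ι ι ℂ} (hU : U ∈ unitaryGroup ι ℂ) (B : Matrix ι ι ℂ) :
    NormedSpace.exp (U * B * Uᴴ) = U * NormedSpace.exp B * Uᴴ := by
  have h1 : U * Uᴴ = 1 := mem_unitaryGroup_iff.1 hU
  have hinv : U⁻¹ = Uᴴ := inv_eq_right_inv h1
  rw [← hinv]
  exact Matrix.exp_conj U B ((isUnit_iff_isUnit_det U).2 (isUnit_det_of_right_inverse h1))

theorem exp_unitary_diagonal {U : Matrix ι ι ℂ} (hU : U ∈ unitaryGroup ι ℂ) (b : ι → ℝ) :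
    NormedSpace.exp (U * diagonal (fun k => (b k : ℂ)) * Uᴴ) =
      U * diagonal (fun k => ((Real.exp (b k) : ℝ) : ℂ)) * Uᴴ := by
  rw [exp_unitary_conj hU, exp_diagonal]
  congr 3
  ext k
  rw [Pi.coe_exp, Complex.ofReal_exp, Complex.exp_eq_exp_ℂ]

theorem trace_mul_unitary_diagonal (A U : Matrix ι ι ℂ) (d : ι → ℂ) :
    (A * (U * diagonal d * Uᴴ)).trace = ∑ k, d k * (Uᴴ * A * U) k k := by
  rw [← mul_assoc, trace_mul_comm, ← mul_assoc, ← mul_assoc, trace]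
  simp [mul_diagonal, mul_comm]

theorem trace_unitary_diagonal {U : Matrix ι ι ℂ} (hU : U ∈ unitaryGroup ι ℂ) (d : ι → ℂ) :
    (U * diagonal d * Uᴴ).trace = ∑ k, d k := by
  rw [trace_mul_comm, ← mul_assoc, show Uᴴ * U = 1 from mem_unitaryGroup_iff'.1 hU, one_mul,
    trace_diagonal]

theorem trace_exp_unitary_diagonal {U : Matrix ι ι ℂ} (hU : U ∈ unitaryGroup ι ℂ) (b : ι → ℝ) :
    (NormedSpace.exp (U * diagonal (fun k => (b k : ℂ)) * Uᴴ)).trace =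
      ((∑ k, Real.exp (b k) : ℝ) : ℂ) := by
  rw [exp_unitary_diagonal hU, trace_unitary_diagonal hU, Complex.ofReal_sum]

theorem trace_exp_eq_re {B : Matrix ι ι ℂ} (hB : B.IsHermitian) :
    (NormedSpace.exp B).trace = ((NormedSpace.exp B).trace.re : ℂ) := by
  obtain ⟨U, hU, b, rfl⟩ := exists_unitary_diagonal hB
  rw [trace_exp_unitary_diagonal hU, Complex.ofReal_re]

theorem trace_exp_pos [Nonempty ι] {B : Matrix ι ι ℂ} (hB : B.IsHermitian) :
    0 < (NormedSpace.exp B).trace.re := by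
  obtain ⟨U, hU, b, rfl⟩ := exists_unitary_diagonal hB
  rw [trace_exp_unitary_diagonal hU, Complex.ofReal_re]
  exact Finset.sum_pos (fun k _ => Real.exp_pos _) Finset.univ_nonempty

/-- **Peierls' inequality**. -/
theorem sum_exp_le_trace_exp {B : Matrix ι ι ℂ} (hB : B.IsHermitian) {V : Matrix ι ι ℂ}
    (hV : V ∈ unitaryGroup ι ℂ) :
    ∑ k, Real.exp ((Vᴴ * B * V) k k).re ≤ (NormedSpace.exp B).trace.re := by
  obtain ⟨U, hU, b, rfl⟩ := exists_unitary_diagonal hB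
  rw [trace_exp_unitary_diagonal hU, Complex.ofReal_re]
  set R := Vᴴ * U with hR
  -- The squared moduli of the entries of the unitary R form a doubly stochastic matrix. The row
  -- sums feed Jensen's inequality, and the column sums recover the trace.
  have hRU : R ∈ unitaryGroup ι ℂ := mul_mem (Unitary.star_mem hV) hU
  have hrow : ∀ k, ∑ l, ‖R k l‖ ^ 2 = 1 := by
    intro k
    have h : (R * Rᴴ) k k = 1 := by
      rw [show R * Rᴴ = 1 from mem_unitaryGroup_iff.1 hRU, one_apply_eq]
    rw [mul_apply] at h
    simp only [conjTranspose_apply, RCLike.star_def, Complex.mul_conj, Complex.normSq_eq_norm_sq]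
      at h
    exact_mod_cast h
  have hcol : ∀ l, ∑ k, ‖R k l‖ ^ 2 = 1 := by
    intro l
    have h : (Rᴴ * R) l l = 1 := by
      rw [show Rᴴ * R = 1 from mem_unitaryGroup_iff'.1 hRU, one_apply_eq]
    rw [mul_apply] at h
    simp only [conjTranspose_apply, RCLike.star_def, mul_comm _ (R _ _), Complex.mul_conj,
      Complex.normSq_eq_norm_sq] at h
    exact_mod_cast h
  have hentry : ∀ k, ((Vᴴ * (U * diagonal (fun k => (b k : ℂ)) * Uᴴ) * V) k k).re =
      ∑ l, ‖R k l‖ ^ 2 * b l := by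
    intro k
    have : Vᴴ * (U * diagonal (fun k => (b k : ℂ)) * Uᴴ) * V =
        R * diagonal (fun k => (b k : ℂ)) * Rᴴ := by
      simp only [hR, conjTranspose_mul, conjTranspose_conjTranspose, mul_assoc]
    rw [this, mul_apply, Complex.re_sum]
    refine Finset.sum_congr rfl fun l _ => ?_
    rw [mul_diagonal, conjTranspose_apply, RCLike.star_def, mul_right_comm, Complex.mul_conj,
      Complex.normSq_eq_norm_sq]
    norm_cast
  calc ∑ k, Real.exp ((Vᴴ * (U * diagonal (fun k => (b k : ℂ)) * Uᴴ) * V) k k).re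
      ≤ ∑ k, ∑ l, ‖R k l‖ ^ 2 * Real.exp (b l) := by
        refine Finset.sum_le_sum fun k _ => ?_
        rw [hentry]
        exact convexOn_exp.map_sum_le (fun l _ => by positivity) (hrow k) fun l _ => Set.mem_univ _
    _ = ∑ l, Real.exp (b l) := by
        rw [Finset.sum_comm]
        simp_rw [← Finset.sum_mul, hcol, one_mul]

/-- The exponential trace is monotone with respect to quadratic forms. -/
theorem trace_exp_le_of_re_le {A B : Matrix ι ι ℂ} (hA : A.IsHermitian) (hB : B.IsHermitian)
    {K : ℝ} (h : ∀ V ∈ unitaryGroup ι ℂ, ∀ k, ((Vᴴ * (A - B) * V) k k).re ≤ K) :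
    (NormedSpace.exp A).trace.re ≤ Real.exp K * (NormedSpace.exp B).trace.re := by
  obtain ⟨U, hU, a, hAU⟩ := exists_unitary_diagonal hA
  have hUU : Uᴴ * U = 1 := mem_unitaryGroup_iff'.1 hU
  have hdiag : ∀ k, a k = ((Uᴴ * A * U) k k).re := by
    intro k
    have : Uᴴ * A * U = diagonal (fun k => (a k : ℂ)) := by
      rw [hAU]
      calc Uᴴ * (U * diagonal (fun k => (a k : ℂ)) * Uᴴ) * U
          = (Uᴴ * U) * diagonal (fun k => (a k : ℂ)) * (Uᴴ * U) := by simp only [mul_assoc]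
        _ = _ := by rw [hUU, one_mul, mul_one]
    rw [this, diagonal_apply_eq, Complex.ofReal_re]
  have h1 : (NormedSpace.exp A).trace.re = ∑ k, Real.exp (a k) := by
    rw [hAU, trace_exp_unitary_diagonal hU, Complex.ofReal_re]
  rw [h1]
  -- Peierls' inequality for B is applied in an eigenbasis of A, where the trace of exp A is an
  -- explicit sum over diagonal entries.
  refine le_trans ?_ (mul_le_mul_of_nonneg_left (sum_exp_le_trace_exp hB hU) (Real.exp_pos K).le)
  rw [Finset.mul_sum]
  refine Finset.sum_le_sum fun k _ => ?_
  rw [← Real.exp_add, Real.exp_le_exp, hdiag]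
  have := h U hU k
  rw [mul_sub, sub_mul, Matrix.sub_apply, Complex.sub_re] at this
  linarith

theorem norm_apply_le_l2_opNorm (A : Matrix ι ι ℂ) (i j : ι) : ‖A i j‖ ≤ ‖A‖ := by
  have h := l2_opNorm_mulVec A (EuclideanSpace.single j 1)
  have h2 := PiLp.norm_apply_le (WithLp.toLp 2 (A *ᵥ (EuclideanSpace.single j (1 : ℂ)))) i
  rw [PiLp.norm_single, norm_one, mul_one] at h
  refine le_trans ?_ (h2.trans h)
  simp

theorem norm_conjTranspose_mul_mul {U : Matrix ι ι ℂ} (hU : U ∈ unitaryGroup ι ℂ)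
    (A : Matrix ι ι ℂ) : ‖Uᴴ * A * U‖ = ‖A‖ := by
  rw [CStarRing.norm_mul_mem_unitary _ hU]
  exact CStarRing.norm_mem_unitary_mul _ (Unitary.star_mem hU)

/-- This is how the on-site terms, of bounded norm, are discarded at the cost of a constant factor.
-/
theorem trace_exp_le_of_norm_sub_le {A B : Matrix ι ι ℂ} (hA : A.IsHermitian)
    (hB : B.IsHermitian) {K : ℝ} (h : ‖A - B‖ ≤ K) :
    (NormedSpace.exp A).trace.re ≤ Real.exp K * (NormedSpace.exp B).trace.re := by
  refine trace_exp_le_of_re_le hA hB fun V hV k => ?_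
  refine (Complex.re_le_norm _).trans ((norm_apply_le_l2_opNorm _ _ _).trans ?_)
  rwa [norm_conjTranspose_mul_mul hV]

theorem trace_exp_le_of_posSemidef {A B : Matrix ι ι ℂ} (hA : A.IsHermitian)
    (hB : B.IsHermitian) (h : (B - A).PosSemidef) :
    (NormedSpace.exp A).trace.re ≤ (NormedSpace.exp B).trace.re := by
  have := trace_exp_le_of_re_le (K := 0) hA hB fun V hV k => by
    have h1 := (h.conjTranspose_mul_mul_same V).diag_nonneg (i := k)
    have h2 := (Complex.le_def.1 h1).1
    rw [← neg_sub B A, mul_neg, neg_mul, Matrix.neg_apply, Complex.neg_re]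
    simpa using h2
  simpa using this

/-- The thermal state with density matrix proportional to `exp K`. -/
noncomputable def thermal (K : Matrix ι ι ℂ) : Matrix ι ι ℂ →ₗ[ℂ] ℂ where
  toFun A := (A * NormedSpace.exp K).trace / (NormedSpace.exp K).trace
  map_add' A B := by rw [add_mul, trace_add, add_div]
  map_smul' c A := by
    rw [smul_mul_assoc, trace_smul, smul_eq_mul, RingHom.id_apply, smul_eq_mul, mul_div_assoc]

theorem thermal_apply (K A : Matrix ι ι ℂ) :
    thermal K A = (A * NormedSpace.exp K).trace / (NormedSpace.exp K).trace := rfl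

/-- The thermal state is a convex combination of the vector states of an eigenbasis. -/
theorem exists_thermal_eq_sum [Nonempty ι] {K : Matrix ι ι ℂ} (hK : K.IsHermitian) :
    ∃ U ∈ unitaryGroup ι ℂ, ∃ b : ι → ℝ, K = U * diagonal (fun k => (b k : ℂ)) * Uᴴ ∧
      ∀ A, thermal K A =
        ∑ k, ((Real.exp (b k) / (NormedSpace.exp K).trace.re : ℝ) : ℂ) * (Uᴴ * A * U) k k := by
  obtain ⟨U, hU, b, hb⟩ := exists_unitary_diagonal hK
  refine ⟨U, hU, b, hb, fun A => ?_⟩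
  have hZ : (NormedSpace.exp K).trace = ((NormedSpace.exp K).trace.re : ℂ) := trace_exp_eq_re hK
  rw [thermal_apply, hZ, Complex.ofReal_re, show NormedSpace.exp K =
    U * diagonal (fun k => ((Real.exp (b k) : ℝ) : ℂ)) * Uᴴ by rw [hb, exp_unitary_diagonal hU],
    trace_mul_unitary_diagonal, Finset.sum_div]
  refine Finset.sum_congr rfl fun k _ => ?_
  push_cast
  ring

theorem sum_exp_div_trace_exp [Nonempty ι] {K U : Matrix ι ι ℂ} (hK : K.IsHermitian)
    (hU : U ∈ unitaryGroup ι ℂ) {b : ι → ℝ} (hb : K = U * diagonal (fun k => (b k : ℂ)) * Uᴴ) :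
    ∑ k, Real.exp (b k) / (NormedSpace.exp K).trace.re = 1 := by
  rw [← Finset.sum_div, div_eq_one_iff_eq (trace_exp_pos hK).ne', hb,
    trace_exp_unitary_diagonal hU, Complex.ofReal_re]

theorem norm_thermal_le [Nonempty ι] {K : Matrix ι ι ℂ} (hK : K.IsHermitian)
    (A : Matrix ι ι ℂ) : ‖thermal K A‖ ≤ ‖A‖ := by
  obtain ⟨U, hU, b, hb, h⟩ := exists_thermal_eq_sum hK
  rw [h]
  refine (norm_sum_le _ _).trans ?_
  have hp : ∀ k, 0 ≤ Real.exp (b k) / (NormedSpace.exp K).trace.re := fun k =>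
    div_nonneg (Real.exp_pos _).le (trace_exp_pos hK).le
  calc ∑ k, ‖((Real.exp (b k) / (NormedSpace.exp K).trace.re : ℝ) : ℂ) * (Uᴴ * A * U) k k‖
      ≤ ∑ k, Real.exp (b k) / (NormedSpace.exp K).trace.re * ‖A‖ := by
        refine Finset.sum_le_sum fun k _ => ?_
        rw [norm_mul, Complex.norm_real, Real.norm_of_nonneg (hp k)]
        refine mul_le_mul_of_nonneg_left ?_ (hp k)
        exact (norm_apply_le_l2_opNorm _ _ _).trans (norm_conjTranspose_mul_mul hU A).le
    _ = ‖A‖ := by rw [← Finset.sum_mul, sum_exp_div_trace_exp hK hU hb, one_mul]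

theorem thermal_one [Nonempty ι] {K : Matrix ι ι ℂ} (hK : K.IsHermitian) : thermal K 1 = 1 := by
  rw [thermal_apply, one_mul, div_self]
  rw [trace_exp_eq_re hK]
  exact_mod_cast (trace_exp_pos hK).ne'

/-- Conserved quantities commute with everything in thermal expectation. -/
theorem thermal_mul_comm {K D : Matrix ι ι ℂ} (h : Commute D K) (A : Matrix ι ι ℂ) :
    thermal K (D * A) = thermal K (A * D) := by
  have hD : Commute D (NormedSpace.exp K) := h.exp_right
  rw [thermal_apply, thermal_apply, mul_assoc, trace_mul_comm, mul_assoc, mul_assoc, hD.eq]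

/-- The Cauchy-Schwarz inequality for thermal states. -/
theorem norm_thermal_mul_sq_le [Nonempty ι] {K : Matrix ι ι ℂ} (hK : K.IsHermitian)
    (B R : Matrix ι ι ℂ) :
    ‖thermal K (B * R)‖ ^ 2 ≤ ‖B‖ ^ 2 * (thermal K (Rᴴ * R)).re := by
  obtain ⟨U, hU, b, hb, h⟩ := exists_thermal_eq_sum hK
  have hUU : U * Uᴴ = 1 := mem_unitaryGroup_iff.1 hU
  -- Each Boltzmann weight is split as √p · √p, one factor for each side of the Cauchy-Schwarz
  -- inequality over pairs of indices.
  set p : ι → ℝ := fun k => Real.exp (b k) / (NormedSpace.exp K).trace.re with hpdef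
  have hp : ∀ k, 0 ≤ p k := fun k => div_nonneg (Real.exp_pos _).le (trace_exp_pos hK).le
  have hsplit : ∀ X Y : Matrix ι ι ℂ, Uᴴ * (X * Y) * U = (Uᴴ * X * U) * (Uᴴ * Y * U) := by
    intro X Y
    calc Uᴴ * (X * Y) * U = Uᴴ * X * 1 * Y * U := by simp only [mul_assoc, one_mul]
      _ = _ := by rw [← hUU]; simp only [mul_assoc]
  set B' := Uᴴ * B * U with hB'
  set R' := Uᴴ * R * U with hR'
  have hRR : Uᴴ * Rᴴ * U = R'ᴴ := by
    simp only [hR', conjTranspose_mul, conjTranspose_conjTranspose, mul_assoc]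
  have h1 : ‖thermal K (B * R)‖ ≤
      ∑ x : ι × ι, (Real.sqrt (p x.1) * ‖B' x.1 x.2‖) * (Real.sqrt (p x.1) * ‖R' x.2 x.1‖) := by
    rw [h, Fintype.sum_prod_type]
    refine (norm_sum_le _ _).trans (Finset.sum_le_sum fun k _ => ?_)
    rw [hsplit, mul_apply, norm_mul, Complex.norm_real, Real.norm_of_nonneg (hp k)]
    refine (mul_le_mul_of_nonneg_left (norm_sum_le _ _) (hp k)).trans ?_
    rw [Finset.mul_sum]
    refine Finset.sum_le_sum fun l _ => ?_
    rw [norm_mul]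
    change p k * (‖B' k l‖ * ‖R' l k‖) ≤ √(p k) * ‖B' k l‖ * (√(p k) * ‖R' l k‖)
    nth_rw 1 [← Real.mul_self_sqrt (hp k)]
    exact le_of_eq (by ring)
  have h2 : ∑ x : ι × ι, (Real.sqrt (p x.1) * ‖B' x.1 x.2‖) ^ 2 ≤ ‖B‖ ^ 2 := by
    rw [Fintype.sum_prod_type]
    calc ∑ k, ∑ l, (Real.sqrt (p k) * ‖B' k l‖) ^ 2 ≤ ∑ k, p k * ‖B‖ ^ 2 := by
          refine Finset.sum_le_sum fun k _ => ?_
          simp_rw [mul_pow, Real.sq_sqrt (hp k), ← Finset.mul_sum]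
          refine mul_le_mul_of_nonneg_left ?_ (hp k)
          have e : ((∑ l, ‖B' k l‖ ^ 2 : ℝ) : ℂ) = (B' * B'ᴴ) k k := by
            rw [mul_apply]
            push_cast
            refine Finset.sum_congr rfl fun l _ => ?_
            rw [conjTranspose_apply, RCLike.star_def, Complex.mul_conj, Complex.normSq_eq_norm_sq]
            push_cast; rfl
          have e2 : ‖(B' * B'ᴴ) k k‖ ≤ ‖B‖ ^ 2 := by
            refine (norm_apply_le_l2_opNorm _ _ _).trans ((norm_mul_le _ _).trans ?_)
            rw [l2_opNorm_conjTranspose, hB', norm_conjTranspose_mul_mul hU, sq]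
          rw [← e, Complex.norm_real] at e2
          exact (le_abs_self _).trans e2
      _ = ‖B‖ ^ 2 := by rw [← Finset.sum_mul, sum_exp_div_trace_exp hK hU hb, one_mul]
  have h3 : ∑ x : ι × ι, (Real.sqrt (p x.1) * ‖R' x.2 x.1‖) ^ 2 = (thermal K (Rᴴ * R)).re := by
    rw [h, Fintype.sum_prod_type, Complex.re_sum]
    refine Finset.sum_congr rfl fun k _ => ?_
    rw [hsplit, hRR, Complex.re_ofReal_mul, mul_apply, Complex.re_sum, Finset.mul_sum]
    refine Finset.sum_congr rfl fun l _ => ?_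
    rw [mul_pow, Real.sq_sqrt (hp k), conjTranspose_apply, RCLike.star_def, mul_comm (_ : ℂ),
      Complex.mul_conj, Complex.normSq_eq_norm_sq, Complex.ofReal_re]
  calc ‖thermal K (B * R)‖ ^ 2 ≤ _ := pow_le_pow_left₀ (norm_nonneg _) h1 2
    _ ≤ _ := Finset.sum_mul_sq_le_sq_mul_sq _ _ _
    _ ≤ _ := by
      rw [h3]
      refine mul_le_mul_of_nonneg_right h2 ?_
      rw [← h3]
      positivity

/-- The **Peierls-Bogoliubov inequality**. -/
theorem exp_thermal_mul_trace_exp_le [Nonempty ι] {K G : Matrix ι ι ℂ} (hK : K.IsHermitian)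
    (hG : G.IsHermitian) :
    Real.exp (thermal K G).re * (NormedSpace.exp K).trace.re ≤
      (NormedSpace.exp (K + G)).trace.re := by
  obtain ⟨U, hU, b, hb, h⟩ := exists_thermal_eq_sum hK
  have hUU : Uᴴ * U = 1 := mem_unitaryGroup_iff'.1 hU
  refine le_trans ?_ (sum_exp_le_trace_exp (hK.add hG) hU)
  have hZ := trace_exp_pos hK
  set p : ι → ℝ := fun k => Real.exp (b k) / (NormedSpace.exp K).trace.re with hpdef
  have hp : ∀ k, 0 ≤ p k := fun k => div_nonneg (Real.exp_pos _).le hZ.le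
  have hre : (thermal K G).re = ∑ k, p k * ((Uᴴ * G * U) k k).re := by
    rw [h, Complex.re_sum]
    exact Finset.sum_congr rfl fun k _ => Complex.re_ofReal_mul _ _
  have hdiag : Uᴴ * K * U = diagonal (fun k => (b k : ℂ)) := by
    nth_rw 1 [hb]
    calc Uᴴ * (U * diagonal (fun k => (b k : ℂ)) * Uᴴ) * U
        = (Uᴴ * U) * diagonal (fun k => (b k : ℂ)) * (Uᴴ * U) := by simp only [mul_assoc]
      _ = _ := by rw [hUU, one_mul, mul_one]
  rw [hre]
  -- Jensen's inequality for the Boltzmann weights of K. Peierls' inequality for K + G in the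
  -- eigenbasis of K has already been used.
  have hj := convexOn_exp.map_sum_le (t := Finset.univ) (w := p)
    (p := fun k => ((Uᴴ * G * U) k k).re) (fun k _ => hp k) (sum_exp_div_trace_exp hK hU hb)
    fun k _ => Set.mem_univ _
  refine (mul_le_mul_of_nonneg_right hj hZ.le).trans (le_of_eq ?_)
  rw [Finset.sum_mul]
  refine Finset.sum_congr rfl fun k _ => ?_
  rw [mul_add, add_mul, hdiag, Matrix.add_apply, diagonal_apply_eq, Complex.add_re,
    Complex.ofReal_re, Real.exp_add, smul_eq_mul, hpdef]
  field_simp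

end Matrices

open Matrix

/-! ### One-site operators -/

/-- With m = S - k one has S(S + 1) - m(m + 1) = k(2S + 1 - k). -/
theorem spinPlus_apply (N : ℕ) (j k : Fin (N + 1)) : spinPlus N j k =
    if (j : ℕ) + 1 = k then ((Real.sqrt (k * (N + 1 - k)) : ℝ) : ℂ) else 0 := by
  unfold spinPlus weight spin
  rw [of_apply]
  congr 4
  ring

theorem spinMinus_apply (N : ℕ) (j k : Fin (N + 1)) : spinMinus N j k =
    if (k : ℕ) + 1 = j then ((Real.sqrt (j * (N + 1 - j)) : ℝ) : ℂ) else 0 := by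
  rw [spinMinus, conjTranspose_apply, spinPlus_apply]
  split_ifs <;> simp

theorem ofReal_sqrt_mul_self {x : ℝ} (hx : 0 ≤ x) :
    ((Real.sqrt x : ℝ) : ℂ) * ((Real.sqrt x : ℝ) : ℂ) = (x : ℂ) := by
  rw [← Complex.ofReal_mul, Real.mul_self_sqrt hx]

theorem spinPlus_mul_spinMinus (N : ℕ) : spinPlus N * spinMinus N =
    diagonal fun k : Fin (N + 1) => (((k + 1) * (N - k) : ℝ) : ℂ) := by
  ext j j'
  rw [mul_apply]
  simp only [spinPlus_apply, spinMinus_apply]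
  by_cases hj : (j : ℕ) + 1 < N + 1
  · rw [Finset.sum_eq_single ⟨j + 1, hj⟩]
    · simp only [if_true, Nat.add_right_cancel_iff, diagonal_apply]
      by_cases h : j = j'
      · subst h
        simp only [if_true]
        rw [ofReal_sqrt_mul_self]
        · push_cast; ring
        · have : ((j : ℕ) : ℝ) + 1 ≤ N := by exact_mod_cast Nat.lt_succ_iff.1 hj
          push_cast
          exact mul_nonneg (by positivity) (by linarith)
      · rw [if_neg h, if_neg fun h' => h (Fin.ext h'.symm), mul_zero]
    · intro k _ hk
      rw [if_neg fun h => hk (Fin.ext h.symm), zero_mul]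
    · simp
  -- The lowest weight j = N: there is no intermediate state, in agreement with the vanishing factor
  -- N - j.
  · rw [Finset.sum_eq_zero, diagonal_apply]
    · have : (j : ℕ) = N := by omega
      split_ifs
      · simp [this]
      · rfl
    · intro k _
      rw [if_neg (by omega), zero_mul]

theorem spinMinus_mul_spinPlus (N : ℕ) : spinMinus N * spinPlus N =
    diagonal fun k : Fin (N + 1) => ((k * (N + 1 - k) : ℝ) : ℂ) := by
  ext j j'
  rw [mul_apply]
  simp only [spinPlus_apply, spinMinus_apply]
  by_cases hj : 0 < (j : ℕ)
  · have hlt : (j : ℕ) - 1 < N + 1 := by omega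
    rw [Finset.sum_eq_single ⟨j - 1, hlt⟩]
    · simp only [Nat.sub_add_cancel hj, if_true, diagonal_apply]
      by_cases h : j = j'
      · subst h
        simp only [if_true]
        rw [ofReal_sqrt_mul_self]
        have : ((j : ℕ) : ℝ) ≤ N := by exact_mod_cast Nat.lt_succ_iff.1 j.2
        exact mul_nonneg (by positivity) (by linarith)
      · rw [if_neg h, if_neg fun h' => h (Fin.ext h'), mul_zero]
    · intro k _ hk
      rw [if_neg fun h => hk (Fin.ext (by simp; omega)), zero_mul]
    · simp
  · rw [Finset.sum_eq_zero, diagonal_apply]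
    · have : (j : ℕ) = 0 := by omega
      split_ifs
      · simp [this]
      · rfl
    · intro k _
      rw [if_neg (by omega), zero_mul]

theorem spinThree_mul_spinPlus (N : ℕ) :
    spinThree N * spinPlus N - spinPlus N * spinThree N = spinPlus N := by
  ext j k
  rw [Matrix.sub_apply, spinThree, diagonal_mul, mul_diagonal, spinPlus_apply]
  split_ifs with h
  · have : ((k : ℕ) : ℂ) = (j : ℕ) + 1 := by exact_mod_cast h.symm
    simp only [weight]
    push_cast
    rw [this]
    ring
  · simp

theorem spinThree_isHermitian (N : ℕ) : (spinThree N).IsHermitian := by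
  rw [spinThree, isHermitian_diagonal_iff]
  intro k
  simp [IsSelfAdjoint]

theorem spinThree_mul_spinMinus (N : ℕ) :
    spinThree N * spinMinus N - spinMinus N * spinThree N = -spinMinus N := by
  have h := congrArg conjTranspose (spinThree_mul_spinPlus N)
  rw [conjTranspose_sub, conjTranspose_mul, conjTranspose_mul, (spinThree_isHermitian N).eq] at h
  rw [← neg_sub, spinMinus, h]

theorem spinPlus_mul_spinMinus_sub (N : ℕ) :
    spinPlus N * spinMinus N - spinMinus N * spinPlus N = (2 : ℂ) • spinThree N := by
  rw [spinPlus_mul_spinMinus, spinMinus_mul_spinPlus, diagonal_sub, spinThree, ← diagonal_smul]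
  congr 1
  ext k
  simp only [weight, spin, Pi.smul_apply, smul_eq_mul]
  push_cast
  ring

theorem spinPlus_eq (N : ℕ) : spinPlus N = spinOne N + Complex.I • spinTwo N := by
  unfold spinOne spinTwo
  have : Complex.I * (1 / (2 * Complex.I)) = 1 / 2 := by
    field_simp [Complex.I_ne_zero]
  rw [smul_smul, this]
  module

theorem spinMinus_eq (N : ℕ) : spinMinus N = spinOne N - Complex.I • spinTwo N := by
  unfold spinOne spinTwo
  have : Complex.I * (1 / (2 * Complex.I)) = 1 / 2 := by
    field_simp [Complex.I_ne_zero]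
  rw [smul_smul, this]
  module

theorem spinOne_isHermitian (N : ℕ) : (spinOne N).IsHermitian := by
  unfold spinOne spinMinus
  rw [IsHermitian, conjTranspose_smul, conjTranspose_add, conjTranspose_conjTranspose,
    add_comm (spinPlus N)]
  simp

theorem spinTwo_isHermitian (N : ℕ) : (spinTwo N).IsHermitian := by
  unfold spinTwo spinMinus
  rw [IsHermitian, conjTranspose_smul, conjTranspose_sub, conjTranspose_conjTranspose,
    ← neg_sub, smul_neg, ← neg_smul]
  simp

theorem spinOne_mul_spinTwo (N : ℕ) :
    spinOne N * spinTwo N - spinTwo N * spinOne N = Complex.I • spinThree N := by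
  have h := spinPlus_mul_spinMinus_sub N
  unfold spinOne spinTwo
  have hI : (1 / (2 * Complex.I) : ℂ) = -Complex.I / 2 := by
    rw [div_eq_div_iff (by simp) (by simp)]
    linear_combination (2 : ℂ) * Complex.I_mul_I
  rw [hI]
  simp only [smul_mul_assoc, mul_smul_comm, add_mul, mul_add, sub_mul, mul_sub]
  linear_combination (norm := module) (Complex.I / 2) • h

theorem spinThree_mul_spinOne (N : ℕ) :
    spinThree N * spinOne N - spinOne N * spinThree N = Complex.I • spinTwo N := by
  have h := spinThree_mul_spinPlus N
  have h' := spinThree_mul_spinMinus N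
  unfold spinOne spinTwo
  have : Complex.I * (1 / (2 * Complex.I)) = 1 / 2 := by
    field_simp [Complex.I_ne_zero]
  rw [smul_smul, this]
  simp only [smul_mul_assoc, mul_smul_comm, add_mul, mul_add]
  linear_combination (norm := module) (1 / 2 : ℂ) • h + (1 / 2 : ℂ) • h'

theorem spinTwo_mul_spinThree (N : ℕ) :
    spinTwo N * spinThree N - spinThree N * spinTwo N = Complex.I • spinOne N := by
  have h := spinThree_mul_spinPlus N
  have h' := spinThree_mul_spinMinus N
  unfold spinOne spinTwo
  have hI : (1 / (2 * Complex.I) : ℂ) = -Complex.I / 2 := by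
    rw [div_eq_div_iff (by simp) (by simp)]
    linear_combination (2 : ℂ) * Complex.I_mul_I
  rw [hI]
  simp only [smul_mul_assoc, mul_smul_comm, sub_mul, mul_sub]
  linear_combination (norm := module) (Complex.I / 2 : ℂ) • h - (Complex.I / 2 : ℂ) • h'

/-! ### Local operators -/

section Local

variable {N n : ℕ}

theorem onSite_apply (i : Fin n) (A : Matrix (Fin (N + 1)) (Fin (N + 1)) ℂ)
    (σ τ : Fin n → Fin (N + 1)) :
    onSite i A σ τ = if ∀ j, j ≠ i → σ j = τ j then A (σ i) (τ i) else 0 := by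
  rw [onSite, of_apply, Finset.prod_ite_zero]
  simp

theorem onSite_mul_apply (i : Fin n) (A : Matrix (Fin (N + 1)) (Fin (N + 1)) ℂ)
    (M : Operator N n) (σ τ : Fin n → Fin (N + 1)) :
    (onSite i A * M) σ τ = ∑ k, A (σ i) k * M (Function.update σ i k) τ := by
  rw [mul_apply]
  symm
  refine Fintype.sum_of_injective (fun k => Function.update σ i k)
    (Function.update_injective σ i) _ _ (fun ρ hρ => ?_) fun k => ?_
  · rw [onSite_apply, if_neg, zero_mul]
    intro h
    refine hρ ⟨ρ i, ?_⟩
    ext j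
    by_cases hj : j = i
    · subst hj; simp
    · simp [hj, h j hj]
  · rw [onSite_apply, if_pos]
    · simp
    · intro j hj
      simp [hj]

theorem onSite_mul (i : Fin n) (A B : Matrix (Fin (N + 1)) (Fin (N + 1)) ℂ) :
    onSite i (A * B) = onSite i A * onSite i B := by
  ext σ τ
  rw [onSite_mul_apply, onSite_apply, mul_apply]
  simp only [onSite_apply, Function.update_self]
  have : ∀ k, (∀ j, j ≠ i → Function.update σ i k j = τ j) ↔ ∀ j, j ≠ i → σ j = τ j := by
    intro k
    refine forall₂_congr fun j hj => ?_
    rw [Function.update_of_ne hj]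
  simp only [this]
  split_ifs <;> simp

theorem onSite_mul_onSite_apply {i j : Fin n} (hij : i ≠ j)
    (A B : Matrix (Fin (N + 1)) (Fin (N + 1)) ℂ) (σ τ : Fin n → Fin (N + 1)) :
    (onSite i A * onSite j B) σ τ =
      if ∀ l, l ≠ i → l ≠ j → σ l = τ l then A (σ i) (τ i) * B (σ j) (τ j) else 0 := by
  rw [onSite_mul_apply, Finset.sum_eq_single (τ i)]
  · rw [onSite_apply, Function.update_of_ne hij.symm]
    have : (∀ l, l ≠ j → Function.update σ i (τ i) l = τ l) ↔
        ∀ l, l ≠ i → l ≠ j → σ l = τ l := by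
      refine forall_congr' fun l => ?_
      by_cases hl : l = i
      · subst hl; simp
      · simp [hl]
    simp only [this]
    split_ifs <;> simp
  · intro k _ hk
    rw [onSite_apply, if_neg, mul_zero]
    intro h
    exact hk (by simpa using h i hij)
  · simp

theorem onSite_commute {i j : Fin n} (hij : i ≠ j)
    (A B : Matrix (Fin (N + 1)) (Fin (N + 1)) ℂ) : Commute (onSite i A) (onSite j B) := by
  ext σ τ
  rw [onSite_mul_onSite_apply hij, onSite_mul_onSite_apply hij.symm, mul_comm]
  congr 1
  refine propext (forall_congr' fun l => ?_)
  tauto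

theorem onSite_diagonal (i : Fin n) (d : Fin (N + 1) → ℂ) :
    onSite i (diagonal d) = diagonal fun σ : Fin n → Fin (N + 1) => d (σ i) := by
  ext σ τ
  rw [onSite_apply, diagonal_apply, diagonal_apply]
  by_cases h : σ = τ
  · subst h; simp
  · rw [if_neg h]
    split_ifs with h1 h2
    · exact absurd (funext fun j => by by_cases hj : j = i; exacts [hj ▸ h2, h1 j hj]) h
    · rfl
    · rfl

/-- The embedding of the one-site operators at the site `i`. -/
noncomputable def onSiteHom (N : ℕ) {n : ℕ} (i : Fin n) :
    Matrix (Fin (N + 1)) (Fin (N + 1)) ℂ →⋆ₐ[ℂ] Operator N n where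
  toFun := onSite i
  map_one' := by rw [← diagonal_one, onSite_diagonal, diagonal_one]
  map_mul' := onSite_mul i
  map_zero' := by ext σ τ; simp [onSite_apply]
  map_add' A B := by
    ext σ τ
    simp only [onSite_apply, Matrix.add_apply]
    split_ifs <;> simp
  commutes' c := by
    rw [algebraMap_eq_diagonal, onSite_diagonal, algebraMap_eq_diagonal]
    rfl
  map_star' A := by
    ext σ τ
    simp only [star_apply, onSite_apply, eq_comm (a := σ _)]
    split_ifs <;> simp

theorem onSiteHom_apply (i : Fin n) (A : Matrix (Fin (N + 1)) (Fin (N + 1)) ℂ) :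
    onSiteHom N i A = onSite i A := rfl

/-- The sum `∑_i A_i` of the copies of a one-site operator. -/
noncomputable def total (n : ℕ) {N : ℕ} :
    Matrix (Fin (N + 1)) (Fin (N + 1)) ℂ →ₗ[ℂ] Operator N n :=
  ∑ i, (onSiteHom N i).toAlgHom.toLinearMap

theorem total_apply (A : Matrix (Fin (N + 1)) (Fin (N + 1)) ℂ) :
    total n A = ∑ i, onSite i A := by
  simp [total, LinearMap.sum_apply, onSiteHom_apply]

theorem total_isHermitian {A : Matrix (Fin (N + 1)) (Fin (N + 1)) ℂ} (hA : A.IsHermitian) :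
    (total n A).IsHermitian := by
  rw [total_apply, IsHermitian, conjTranspose_sum]
  refine Finset.sum_congr rfl fun i _ => ?_
  rw [← onSiteHom_apply]
  change star (onSiteHom N i A) = _
  rw [← map_star, show star A = A from hA]

/-- Operators on different sites commute, so only the diagonal terms of the double sum survive. The
one-site su(2) relations thus pass to the total spin. -/
theorem total_mul_total_sub (A B : Matrix (Fin (N + 1)) (Fin (N + 1)) ℂ) :
    total n A * total n B - total n B * total n A = total n (A * B - B * A) := by
  simp only [total_apply, Finset.sum_mul_sum]
  rw [Finset.sum_comm (f := fun i j => onSite i B * onSite j A), ← Finset.sum_sub_distrib]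
  refine Finset.sum_congr rfl fun i _ => ?_
  rw [← Finset.sum_sub_distrib, Finset.sum_eq_single i]
  · simp only [← onSiteHom_apply, map_sub, map_mul]
  · intro j _ hj
    rw [(onSite_commute hj.symm A B).eq, sub_self]
  · simp

theorem total_mul_self (A : Matrix (Fin (N + 1)) (Fin (N + 1)) ℂ) :
    total n A * total n A =
      (2 : ℂ) • ∑ i : Fin n, ∑ j ∈ Finset.Ioi i, onSite i A * onSite j A + total n (A * A) := by
  have h : ∀ i : Fin n, ∑ j, onSite i A * onSite j A = ∑ j ∈ Finset.Ioi i, onSite i A * onSite j A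
      + ∑ j ∈ Finset.Iio i, onSite i A * onSite j A + onSite i (A * A) := by
    intro i
    rw [onSite_mul, ← Finset.sum_disjUnion (Finset.disjoint_left.2 fun j => by simp; omega),
      ← Finset.sum_erase_add _ _ (Finset.mem_univ i)]
    congr 2
    ext j
    simp [lt_or_lt_iff_ne, eq_comm]
  rw [total_apply, Finset.sum_mul_sum, Finset.sum_congr rfl fun i _ => h i,
    Finset.sum_add_distrib, Finset.sum_add_distrib, ← total_apply,
    Finset.sum_comm' (s := Finset.univ) (t := fun i => Finset.Iio i)
      (t' := Finset.univ) (s' := fun j => Finset.Ioi j) (by simp), two_smul]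
  congr 2
  refine Finset.sum_congr rfl fun i _ => Finset.sum_congr rfl fun j hj => ?_
  exact onSite_commute (by rintro rfl; simp at hj) A A

end Local

/-! ### Consequences of the `su(2)` relations -/

section SuTwo

variable {R : Type*} [Ring R] [Algebra ℂ R] {x y z : R}

theorem lowering_mul_raising (hxy : x * y - y * x = Complex.I • z) :
    (x - Complex.I • y) * (x + Complex.I • y) = (x * x + y * y + z * z) - z * z - z := by
  have h1 : Complex.I * Complex.I = -1 := Complex.I_mul_I
  have h2 : (x - Complex.I • y) * (x + Complex.I • y) =
      x * x + y * y + Complex.I • (x * y - y * x) := by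
    simp only [sub_mul, mul_add, smul_mul_assoc, mul_smul_comm, smul_sub,
      smul_smul, h1]
    module
  rw [h2, hxy, smul_smul, h1]
  module

theorem raising_mul_lowering (hxy : x * y - y * x = Complex.I • z) :
    (x + Complex.I • y) * (x - Complex.I • y) = (x * x + y * y + z * z) - z * z + z := by
  have h1 : Complex.I * Complex.I = -1 := Complex.I_mul_I
  have h2 : (x + Complex.I • y) * (x - Complex.I • y) =
      x * x + y * y - Complex.I • (x * y - y * x) := by
    simp only [add_mul, mul_sub, smul_mul_assoc, mul_smul_comm, smul_add,
      smul_sub, smul_smul, h1]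
    module
  rw [h2, hxy, smul_smul, h1]
  module

/-- The Leibniz rule gives i(yx + xy) - i(xy + yx). This serves both the centrality of the Casimir
operator and the conservation of T₃ by the Hamiltonian. -/
theorem sum_sq_commute (hzx : z * x - x * z = Complex.I • y)
    (hyz : y * z - z * y = Complex.I • x) : Commute z (x * x + y * y) := by
  have h1 : z * (x * x + y * y) - (x * x + y * y) * z =
      (z * x - x * z) * x + x * (z * x - x * z) - (y * z - z * y) * y - y * (y * z - z * y) := by
    noncomm_ring
  rw [hzx, hyz] at h1
  refine sub_eq_zero.1 (h1.trans ?_)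
  simp only [smul_mul_assoc, mul_smul_comm]
  module

theorem casimir_commute (hzx : z * x - x * z = Complex.I • y)
    (hyz : y * z - z * y = Complex.I • x) : Commute z (x * x + y * y + z * z) :=
  (sum_sq_commute hzx hyz).add_right ((Commute.refl z).mul_right (Commute.refl z))

end SuTwo

section Rotation

variable {R : Type*} [NormedRing R] [NormedAlgebra ℂ R] [CompleteSpace R]

/-- If `ad_Y` acts on the span of `x` and `z` as the generator of rotations, then conjugation by
`exp (θ Y)` rotates `x` and `z`. -/
theorem exp_mul_rotation_mul_exp_neg {x z Y : R} (hx : Y * x - x * Y = z)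
    (hz : Y * z - z * Y = -x) (θ : ℂ) :
    NormedSpace.exp (θ • Y) * (Complex.cos θ • x - Complex.sin θ • z) *
      NormedSpace.exp (θ • (-Y)) = x := by
  -- The left-hand side is constant in θ, and at θ = 0 it equals x.
  have hd : ∀ t : ℂ, HasDerivAt (fun θ : ℂ => NormedSpace.exp (θ • Y) *
      (Complex.cos θ • x - Complex.sin θ • z) * NormedSpace.exp (θ • (-Y))) 0 t := by
    intro t
    have h1 := hasDerivAt_exp_smul_const (𝕂 := ℂ) Y t
    have h2 := hasDerivAt_exp_smul_const' (𝕂 := ℂ) (-Y) t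
    have h3 := ((Complex.hasDerivAt_cos t).smul_const x).sub
      ((Complex.hasDerivAt_sin t).smul_const z)
    refine ((h1.mul h3).mul h2).congr_deriv ?_
    have key : Y * (Complex.cos t • x - Complex.sin t • z) +
        (-Complex.sin t • x - Complex.cos t • z) -
        (Complex.cos t • x - Complex.sin t • z) * Y = 0 := by
      have e : Y * (Complex.cos t • x - Complex.sin t • z) -
          (Complex.cos t • x - Complex.sin t • z) * Y =
          Complex.cos t • (Y * x - x * Y) - Complex.sin t • (Y * z - z * Y) := by
        simp only [mul_sub, sub_mul, smul_mul_assoc, mul_smul_comm]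
        module
      rw [add_sub_right_comm, e, hx, hz]
      module
    calc _ = NormedSpace.exp (t • Y) * (Y * (Complex.cos t • x - Complex.sin t • z) +
        (-Complex.sin t • x - Complex.cos t • z) -
        (Complex.cos t • x - Complex.sin t • z) * Y) * NormedSpace.exp (t • -Y) := by
          simp only [Pi.mul_apply, Pi.sub_apply]
          noncomm_ring
      _ = 0 := by rw [key, mul_zero, zero_mul]
  have hconst := is_const_of_deriv_eq_zero (𝕜 := ℂ) (fun t => (hd t).differentiableAt)
    (fun t => (hd t).deriv) θ 0
  simpa using hconst

end Rotation

/-! ### Total spin operators -/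

section Total

variable (N n : ℕ)

theorem totalOne_mul_totalTwo :
    total n (spinOne N) * total n (spinTwo N) - total n (spinTwo N) * total n (spinOne N) =
      Complex.I • total n (spinThree N) := by
  rw [total_mul_total_sub, spinOne_mul_spinTwo, map_smul]

theorem totalTwo_mul_totalThree :
    total n (spinTwo N) * total n (spinThree N) - total n (spinThree N) * total n (spinTwo N) =
      Complex.I • total n (spinOne N) := by
  rw [total_mul_total_sub, spinTwo_mul_spinThree, map_smul]

theorem totalThree_mul_totalOne :
    total n (spinThree N) * total n (spinOne N) - total n (spinOne N) * total n (spinThree N) =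
      Complex.I • total n (spinTwo N) := by
  rw [total_mul_total_sub, spinThree_mul_spinOne, map_smul]

/-- The square of the total spin. -/
noncomputable def casimir : Operator N n :=
  total n (spinOne N) * total n (spinOne N) + total n (spinTwo N) * total n (spinTwo N) +
    total n (spinThree N) * total n (spinThree N)

variable {N n}

/-- The total weight of a configuration. -/
noncomputable def totalWeight (σ : Fin n → Fin (N + 1)) : ℝ := ∑ i, weight N (σ i)

theorem totalThree_eq_diagonal : total n (spinThree N) =
    diagonal fun σ : Fin n → Fin (N + 1) => ((totalWeight σ : ℝ) : ℂ) := by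
  rw [total_apply, spinThree]
  simp only [onSite_diagonal, totalWeight, Complex.ofReal_sum]
  ext σ τ
  rw [Matrix.sum_apply]
  simp only [diagonal_apply]
  split_ifs <;> simp

theorem sum_exp_mul_totalWeight (x : ℝ) :
    ∑ σ : Fin n → Fin (N + 1), Real.exp (x * totalWeight σ) = Real.exp (n * eta N x) := by
  have h : ∀ σ : Fin n → Fin (N + 1),
      Real.exp (x * totalWeight σ) = ∏ i, Real.exp (weight N (σ i) * x) := by
    intro σ
    rw [← Real.exp_sum, totalWeight, Finset.mul_sum]
    simp only [mul_comm x]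
  rw [Finset.sum_congr rfl fun σ _ => h σ, Real.exp_nat_mul, exp_eta, weightSum]
  simp only [pow_zero, one_mul]
  exact (Fintype.sum_pow (fun k : Fin (N + 1) => Real.exp (weight N k * x)) n).symm

open scoped Matrix.Norms.L2Operator in
-- Each embedding of a site is a star homomorphism, hence a contraction.
theorem norm_total_le (A : Matrix (Fin (N + 1)) (Fin (N + 1)) ℂ) : ‖total n A‖ ≤ n * ‖A‖ := by
  rw [total_apply]
  refine (norm_sum_le _ _).trans ?_
  calc ∑ i : Fin n, ‖onSite i A‖ ≤ ∑ _i : Fin n, ‖A‖ := by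
        refine Finset.sum_le_sum fun i _ => ?_
        rw [← onSiteHom_apply]
        exact NonUnitalStarAlgHom.norm_apply_le (onSiteHom N i) A
    _ = n * ‖A‖ := by simp

/-- The collective part of `-β H`. -/
noncomputable def collective (N n : ℕ) (β Δ : ℝ) : Operator N n :=
  ((β / n : ℝ) : ℂ) • (total n (spinOne N) * total n (spinOne N) +
    total n (spinTwo N) * total n (spinTwo N) +
    (Δ : ℂ) • (total n (spinThree N) * total n (spinThree N)))

/-- The sum of one-site operators by which `-β H` differs from its collective part. -/
noncomputable def onSiteEnergy (N : ℕ) (Δ : ℝ) : Matrix (Fin (N + 1)) (Fin (N + 1)) ℂ :=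
  spinOne N * spinOne N + spinTwo N * spinTwo N + (Δ : ℂ) • (spinThree N * spinThree N)

/-- The square of a total operator is twice the sum over pairs i < j plus the diagonal terms. The
latter must be subtracted. -/
theorem neg_smul_heisenberg (β Δ : ℝ) : (-(β : ℂ)) • heisenberg N n Δ =
    collective N n β Δ - ((β / n : ℝ) : ℂ) • total n (onSiteEnergy N Δ) := by
  unfold heisenberg collective onSiteEnergy
  simp only [Finset.sum_add_distrib, ← Finset.smul_sum, map_add, map_smul, total_mul_self]
  push_cast
  module

theorem IsHermitian.mul_self {ι : Type*} [Fintype ι] {A : Matrix ι ι ℂ} (hA : A.IsHermitian) :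
    (A * A).IsHermitian := by
  rw [IsHermitian, conjTranspose_mul, hA.eq]

theorem IsHermitian.ofReal_smul {ι : Type*} {A : Matrix ι ι ℂ} (hA : A.IsHermitian) (c : ℝ) :
    ((c : ℂ) • A).IsHermitian := by
  rw [IsHermitian, conjTranspose_smul, hA.eq]
  simp

theorem totalOne_isHermitian : (total n (spinOne N)).IsHermitian :=
  total_isHermitian (spinOne_isHermitian N)

theorem totalTwo_isHermitian : (total n (spinTwo N)).IsHermitian :=
  total_isHermitian (spinTwo_isHermitian N)

theorem totalThree_isHermitian : (total n (spinThree N)).IsHermitian :=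
  total_isHermitian (spinThree_isHermitian N)

theorem collective_isHermitian (β Δ : ℝ) : (collective N n β Δ).IsHermitian :=
  IsHermitian.ofReal_smul (((IsHermitian.mul_self totalOne_isHermitian).add
    (IsHermitian.mul_self totalTwo_isHermitian)).add
    (IsHermitian.ofReal_smul (IsHermitian.mul_self totalThree_isHermitian) Δ)) _

theorem casimir_isHermitian : (casimir N n).IsHermitian :=
  ((IsHermitian.mul_self totalOne_isHermitian).add
    (IsHermitian.mul_self totalTwo_isHermitian)).add
    (IsHermitian.mul_self totalThree_isHermitian)

theorem onSiteEnergy_isHermitian (Δ : ℝ) : (onSiteEnergy N Δ).IsHermitian :=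
  ((IsHermitian.mul_self (spinOne_isHermitian N)).add
    (IsHermitian.mul_self (spinTwo_isHermitian N))).add
    (IsHermitian.ofReal_smul (IsHermitian.mul_self (spinThree_isHermitian N)) Δ)

theorem neg_smul_heisenberg_isHermitian (β Δ : ℝ) :
    ((-(β : ℂ)) • heisenberg N n Δ).IsHermitian := by
  rw [neg_smul_heisenberg]
  exact (collective_isHermitian β Δ).sub
    (IsHermitian.ofReal_smul (total_isHermitian (onSiteEnergy_isHermitian Δ)) _)

open scoped Matrix.Norms.L2Operator in
theorem norm_neg_smul_heisenberg_sub_le {β : ℝ} (hβ : 0 < β) (Δ : ℝ) :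
    ‖(-(β : ℂ)) • heisenberg N n Δ - collective N n β Δ‖ ≤ β * ‖onSiteEnergy N Δ‖ := by
  rw [neg_smul_heisenberg, sub_sub_cancel_left, norm_neg, norm_smul, Complex.norm_real,
    Real.norm_of_nonneg (by positivity)]
  rcases Nat.eq_zero_or_pos n with rfl | hn
  · simp
    positivity
  · refine (mul_le_mul_of_nonneg_left (norm_total_le _) (by positivity)).trans (le_of_eq ?_)
    field_simp

/-- The collective Hamiltonian, rotated about the second axis. -/
noncomputable def rotatedCollective (N n : ℕ) (β Δ : ℝ) : Operator N n :=
  ((β / n : ℝ) : ℂ) • (total n (spinThree N) * total n (spinThree N) +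
    total n (spinTwo N) * total n (spinTwo N) +
    (Δ : ℂ) • (total n (spinOne N) * total n (spinOne N)))

open scoped Matrix.Norms.L2Operator in
-- A quarter turn about the second axis exchanges T₁² and T₃² and fixes T₂. The term with
-- coefficient 1 thereby becomes diagonal in the product basis.
theorem trace_exp_collective (β Δ : ℝ) : (NormedSpace.exp (collective N n β Δ)).trace =
    (NormedSpace.exp (rotatedCollective N n β Δ)).trace := by
  set x := total n (spinOne N) with hx
  set y := total n (spinTwo N) with hy
  set z := total n (spinThree N) with hz
  set Y := Complex.I • y with hY
  have hYx : Y * x - x * Y = z := by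
    have h := totalOne_mul_totalTwo N n
    rw [← hx, ← hy, ← hz] at h
    have : Y * x - x * Y = -(Complex.I • (x * y - y * x)) := by
      rw [hY, smul_mul_assoc, mul_smul_comm]; module
    rw [this, h, smul_smul, Complex.I_mul_I]
    module
  have hYz : Y * z - z * Y = -x := by
    have h := totalTwo_mul_totalThree N n
    rw [← hx, ← hy, ← hz] at h
    have : Y * z - z * Y = Complex.I • (y * z - z * y) := by
      rw [hY, smul_mul_assoc, mul_smul_comm]; module
    rw [this, h, smul_smul, Complex.I_mul_I]
    module
  set E := NormedSpace.exp (((Real.pi / 2 : ℝ) : ℂ) • Y) with hE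
  have hEu : IsUnit E := Matrix.isUnit_exp _
  have hEinv : NormedSpace.exp (((Real.pi / 2 : ℝ) : ℂ) • (-Y)) = E⁻¹ := by
    rw [smul_neg, Matrix.exp_neg]
  have hdet : IsUnit E.det := (isUnit_iff_isUnit_det E).1 hEu
  have h1 := exp_mul_rotation_mul_exp_neg hYx hYz ((Real.pi / 2 : ℝ) : ℂ)
  have h2 := exp_mul_rotation_mul_exp_neg (x := z) (z := -x) (Y := Y) hYz
    (by rw [mul_neg, neg_mul, sub_neg_eq_add, neg_add_eq_sub, ← hYx, neg_sub])
    ((Real.pi / 2 : ℝ) : ℂ)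
  rw [← Complex.ofReal_cos, ← Complex.ofReal_sin, Real.cos_pi_div_two, Real.sin_pi_div_two,
    hEinv] at h1 h2
  simp only [Complex.ofReal_zero, Complex.ofReal_one, zero_smul, one_smul, zero_sub, neg_neg,
    ← hE] at h1 h2
  have h3 : E * y * E⁻¹ = y := by
    have hc : Commute y E := by
      rw [hE, hY]
      exact (((Commute.refl y).smul_right _).smul_right _).exp_right
    rw [← hc.eq, mul_assoc, mul_nonsing_inv _ hdet, mul_one]
  have hmul : ∀ A B : Operator N n, E * (A * B) * E⁻¹ = (E * A * E⁻¹) * (E * B * E⁻¹) := by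
    intro A B
    calc E * (A * B) * E⁻¹ = E * A * 1 * B * E⁻¹ := by simp only [mul_assoc, one_mul]
      _ = _ := by rw [← nonsing_inv_mul _ hdet]; simp only [mul_assoc]
  have hzz : E * (z * z) * E⁻¹ = x * x := by
    rw [← neg_mul_neg z z, hmul, h1]
  have hrot : collective N n β Δ = E * rotatedCollective N n β Δ * E⁻¹ := by
    rw [collective, rotatedCollective, ← hx, ← hy, ← hz]
    simp only [mul_smul_comm, smul_mul_assoc, mul_add, add_mul]
    rw [hzz, hmul y y, h3, hmul x x, h2]
  rw [hrot, Matrix.exp_conj E _ hEu, trace_mul_comm, ← mul_assoc, nonsing_inv_mul _ hdet, one_mul]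

/-- An operator that shifts the total weight by a non-zero amount has no diagonal. -/
theorem diag_eq_zero_of_commutator {X : Operator N n} {c : ℂ} (hc : c ≠ 0)
    (h : total n (spinThree N) * X - X * total n (spinThree N) = c • X)
    (σ : Fin n → Fin (N + 1)) : X σ σ = 0 := by
  have := congrFun (congrFun h σ) σ
  rw [totalThree_eq_diagonal, Matrix.sub_apply, diagonal_mul, mul_diagonal, mul_comm, sub_self,
    Matrix.smul_apply, smul_eq_mul, eq_comm, mul_eq_zero] at this
  exact this.resolve_left hc

theorem totalThree_mul_totalPlus : total n (spinThree N) * total n (spinPlus N) -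
    total n (spinPlus N) * total n (spinThree N) = total n (spinPlus N) := by
  rw [total_mul_total_sub, spinThree_mul_spinPlus]

theorem totalThree_mul_totalMinus : total n (spinThree N) * total n (spinMinus N) -
    total n (spinMinus N) * total n (spinThree N) = -total n (spinMinus N) := by
  rw [total_mul_total_sub, spinThree_mul_spinMinus, map_neg]

theorem commutator_mul_self {R : Type*} [Ring R] [Algebra ℂ R] {a b : R} {c : ℂ}
    (h : a * b - b * a = c • b) : a * (b * b) - b * b * a = (2 * c) • (b * b) := by
  have : a * (b * b) - b * b * a = (a * b - b * a) * b + b * (a * b - b * a) := by noncomm_ring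
  rw [this, h, smul_mul_assoc, mul_smul_comm]
  module

/-- The difference 2(T₁² - T₂²) is the sum of the squares of the raising and lowering operators,
which shift the weight by ±2. -/
theorem totalTwo_sq_diag (σ : Fin n → Fin (N + 1)) :
    (total n (spinTwo N) * total n (spinTwo N)) σ σ =
      (total n (spinOne N) * total n (spinOne N)) σ σ := by
  have hp := diag_eq_zero_of_commutator (c := 2 * 1) (by norm_num) (commutator_mul_self (c := 1)
    (by rw [one_smul]; exact totalThree_mul_totalPlus (N := N) (n := n))) σ
  have hm := diag_eq_zero_of_commutator (c := 2 * -1) (by norm_num) (commutator_mul_self (c := -1)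
    (by rw [neg_smul, one_smul]; exact totalThree_mul_totalMinus (N := N) (n := n))) σ
  have hsum : total n (spinPlus N) * total n (spinPlus N) +
      total n (spinMinus N) * total n (spinMinus N) =
      (2 : ℂ) • (total n (spinOne N) * total n (spinOne N)) -
      (2 : ℂ) • (total n (spinTwo N) * total n (spinTwo N)) := by
    rw [spinPlus_eq, spinMinus_eq, map_add, map_sub, map_smul]
    have h1 : Complex.I * Complex.I = -1 := Complex.I_mul_I
    simp only [add_mul, mul_add, sub_mul, mul_sub, smul_mul_assoc, mul_smul_comm, smul_add,
      smul_sub, smul_smul, h1]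
    module
  have h := congrFun (congrFun hsum σ) σ
  rw [Matrix.add_apply, hp, hm, Matrix.sub_apply, Matrix.smul_apply, Matrix.smul_apply,
    smul_eq_mul, smul_eq_mul] at h
  linear_combination (1 / 2 : ℂ) * h

open scoped ComplexOrder in
/-- A lower bound on the partition function. -/
theorem exp_le_trace_exp_collective {β Δ : ℝ} (hβ : 0 < β) (hΔ : -1 ≤ Δ) (hn : 0 < n) (m : ℝ) :
    Real.exp (n * (eta N (2 * β * m) - β * m ^ 2)) ≤
      (NormedSpace.exp (collective N n β Δ)).trace.re := by
  rw [trace_exp_collective]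
  have hH : (rotatedCollective N n β Δ).IsHermitian :=
    IsHermitian.ofReal_smul (((IsHermitian.mul_self totalThree_isHermitian).add
      (IsHermitian.mul_self totalTwo_isHermitian)).add
      (IsHermitian.ofReal_smul (IsHermitian.mul_self totalOne_isHermitian) Δ)) _
  refine le_trans ?_ (sum_exp_le_trace_exp hH (one_mem _))
  have hn' : (0 : ℝ) < n := by exact_mod_cast hn
  rw [mul_sub, Real.exp_sub, ← sum_exp_mul_totalWeight, Finset.sum_div]
  refine Finset.sum_le_sum fun σ _ => ?_
  rw [← Real.exp_sub, Real.exp_le_exp, conjTranspose_one, one_mul, mul_one]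
  have h1 : 0 ≤ ((total n (spinOne N) * total n (spinOne N)) σ σ).re := by
    have h := (posSemidef_conjTranspose_mul_self (total n (spinOne N))).diag_nonneg (i := σ)
    rw [totalOne_isHermitian.eq] at h
    exact (Complex.le_def.1 h).1
  have h3 : (total n (spinThree N) * total n (spinThree N)) σ σ =
      ((totalWeight σ ^ 2 : ℝ) : ℂ) := by
    rw [totalThree_eq_diagonal, diagonal_mul_diagonal, diagonal_apply_eq, sq]
    push_cast; rfl
  have h4 : ((rotatedCollective N n β Δ) σ σ).re = β / n * (totalWeight σ ^ 2 +
      (1 + Δ) * ((total n (spinOne N) * total n (spinOne N)) σ σ).re) := by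
    rw [rotatedCollective, Matrix.smul_apply, Matrix.add_apply, Matrix.add_apply,
      Matrix.smul_apply, h3, totalTwo_sq_diag, smul_eq_mul, smul_eq_mul, Complex.re_ofReal_mul,
      Complex.add_re, Complex.add_re, Complex.re_ofReal_mul, Complex.ofReal_re]
    ring
  rw [h4]
  -- The diagonals of T₂² and T₁² agree, so the transverse part has coefficient 1 + Δ. This is where
  -- Δ ≥ -1 enters.
  have h5 : 0 ≤ β / n * ((1 + Δ) * ((total n (spinOne N) * total n (spinOne N)) σ σ).re) :=
    mul_nonneg (by positivity) (mul_nonneg (by linarith) h1)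
  -- Completing the square linearises βμ²/n around μ = nm. The resulting sum factorises over the
  -- sites and gives η(2βm).
  have h6 : 0 ≤ β / n * (totalWeight σ - n * m) ^ 2 := by positivity
  have h7 : β / n * (totalWeight σ - n * m) ^ 2 =
      β / n * totalWeight σ ^ 2 - (2 * β * m * totalWeight σ - n * (β * m ^ 2)) := by
    field_simp
    ring
  linarith

end Total

/-! ### Spectral projections -/

section SpectralProjection

open scoped ComplexOrder in
-- For projections, Tr(EP) = Tr((EP)ᴴ(EP)).
theorem trace_mul_re_nonneg {ι : Type*} [Fintype ι] {E P : Matrix ι ι ℂ} (hE : E.IsHermitian)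
    (hEE : E * E = E) (hP : P.IsHermitian) (hPP : P * P = P) : 0 ≤ (E * P).trace.re := by
  have h : (E * P).trace = ((E * P)ᴴ * (E * P)).trace := by
    calc (E * P).trace = (E * E * (P * P)).trace := by rw [hEE, hPP]
      _ = (E * (E * P) * P).trace := by simp only [mul_assoc]
      _ = ((E * P)ᴴ * (E * P)).trace := by
        rw [trace_mul_comm, conjTranspose_mul, hE.eq, hP.eq, mul_assoc]
  rw [h]
  exact (Complex.le_def.1 (posSemidef_conjTranspose_mul_self (E * P)).trace_nonneg).1

variable {ι : Type*} [Fintype ι] [DecidableEq ι]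

theorem trace_mul_re_le {E P : Matrix ι ι ℂ} (hE : E.IsHermitian) (hEE : E * E = E)
    (hP : P.IsHermitian) (hPP : P * P = P) : (E * P).trace.re ≤ P.trace.re := by
  have h := trace_mul_re_nonneg (E := 1 - E) (isHermitian_one.sub hE)
    (by rw [sub_mul, mul_sub, mul_sub, hEE]; simp) hP hPP
  rw [sub_mul, one_mul, trace_sub, Complex.sub_re] at h
  linarith

/-- The projection onto the eigenspace with eigenvalue `l` of `U * diagonal b * Uᴴ`. -/
noncomputable def spectralProjection (U : Matrix ι ι ℂ) (b : ι → ℝ) (l : ℝ) : Matrix ι ι ℂ :=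
  U * diagonal (fun k => if b k = l then 1 else 0) * Uᴴ

variable {U : Matrix ι ι ℂ} (hU : U ∈ unitaryGroup ι ℂ) (b : ι → ℝ) (l : ℝ)
include hU

theorem conj_mul_conj (A B : Matrix ι ι ℂ) : (U * A * Uᴴ) * (U * B * Uᴴ) = U * (A * B) * Uᴴ := by
  calc (U * A * Uᴴ) * (U * B * Uᴴ) = U * A * (Uᴴ * U) * B * Uᴴ := by simp only [mul_assoc]
    _ = _ := by
      rw [show Uᴴ * U = 1 from mem_unitaryGroup_iff'.1 hU, mul_one]; simp only [mul_assoc]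

/-- Conjugation by a unitary matrix. -/
noncomputable def unitaryConj : Matrix ι ι ℂ →ₐ[ℂ] Matrix ι ι ℂ :=
  AlgHom.ofLinearMap
    { toFun := fun A => U * A * Uᴴ
      map_add' := fun A B => by rw [mul_add, add_mul]
      map_smul' := fun c A => by rw [mul_smul_comm, smul_mul_assoc, RingHom.id_apply] }
    (by
      change U * 1 * Uᴴ = 1
      rw [mul_one]
      exact mem_unitaryGroup_iff.1 hU)
    (fun A B => (conj_mul_conj hU A B).symm)

theorem unitaryConj_apply (A : Matrix ι ι ℂ) : unitaryConj hU A = U * A * Uᴴ := rfl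

theorem spectralProjection_mul_self :
    spectralProjection U b l * spectralProjection U b l = spectralProjection U b l := by
  rw [spectralProjection, conj_mul_conj hU, diagonal_mul_diagonal]
  congr 3
  ext k
  split_ifs <;> simp

omit hU in
theorem spectralProjection_isHermitian : (spectralProjection U b l).IsHermitian := by
  rw [spectralProjection]
  refine isHermitian_mul_mul_conjTranspose U ?_
  rw [isHermitian_diagonal_iff]
  intro k
  split_ifs <;> simp [IsSelfAdjoint]

theorem spectralProjection_mul :
    spectralProjection U b l * (U * diagonal (fun k => (b k : ℂ)) * Uᴴ) =
      (l : ℂ) • spectralProjection U b l := by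
  rw [spectralProjection, conj_mul_conj hU, diagonal_mul_diagonal, ← smul_mul_assoc,
    ← mul_smul_comm, ← diagonal_smul]
  congr 3
  ext k
  by_cases h : b k = l <;> simp [h]

/-- In the eigenbasis, commutation annihilates the entries of A between different eigenvalues. -/
theorem spectralProjection_commute {A : Matrix ι ι ℂ}
    (hA : Commute A (U * diagonal (fun k => (b k : ℂ)) * Uᴴ)) :
    Commute A (spectralProjection U b l) := by
  have hUU : Uᴴ * U = 1 := mem_unitaryGroup_iff'.1 hU
  have hUU' : U * Uᴴ = 1 := mem_unitaryGroup_iff.1 hU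
  set A' := Uᴴ * A * U with hA'
  have hAA : A = U * A' * Uᴴ := by
    calc A = (U * Uᴴ) * A * (U * Uᴴ) := by rw [hUU', one_mul, mul_one]
      _ = _ := by simp only [hA', mul_assoc]
  have hinj : ∀ X Y : Matrix ι ι ℂ, U * X * Uᴴ = U * Y * Uᴴ → X = Y := by
    intro X Y h
    have e : ∀ Z : Matrix ι ι ℂ, Uᴴ * (U * Z * Uᴴ) * U = Z := by
      intro Z
      calc Uᴴ * (U * Z * Uᴴ) * U = (Uᴴ * U) * Z * (Uᴴ * U) := by simp only [mul_assoc]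
        _ = Z := by rw [hUU, one_mul, mul_one]
    rw [← e X, h, e Y]
  rw [hAA] at hA ⊢
  have h := hA.eq
  rw [conj_mul_conj hU, conj_mul_conj hU] at h
  have h := hinj _ _ h
  rw [Commute, SemiconjBy, spectralProjection, conj_mul_conj hU, conj_mul_conj hU]
  congr 2
  ext i j
  have hij := congrFun (congrFun h i) j
  rw [mul_diagonal, diagonal_mul] at hij ⊢
  by_cases hne : b i = b j
  · rw [hne]; ring
  · have : A' i j = 0 := by
      have h0 : ((b j : ℂ) - b i) * A' i j = 0 := by linear_combination hij
      refine (mul_eq_zero.1 h0).resolve_left fun h1 => hne ?_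
      exact_mod_cast (sub_eq_zero.1 h1).symm
    rw [this]; simp

theorem trace_spectralProjection : (spectralProjection U b l).trace.re =
    (Finset.univ.filter fun k => b k = l).card := by
  rw [spectralProjection, trace_unitary_diagonal hU, Finset.sum_boole]
  simp

end SpectralProjection

/-! ### Multiplicities of the total spin -/

section Casimir

variable {N n : ℕ}

/-- The number of lowering steps from the configuration of maximal weight. -/
def level (σ : Fin n → Fin (N + 1)) : ℕ := ∑ i, (σ i : ℕ)

theorem totalWeight_eq (σ : Fin n → Fin (N + 1)) : totalWeight σ = n * spin N - level σ := by
  simp [totalWeight, weight, level, Finset.sum_sub_distrib]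

theorem level_le (σ : Fin n → Fin (N + 1)) : level σ ≤ n * N := by
  unfold level
  calc ∑ i, (σ i : ℕ) ≤ ∑ _i : Fin n, N := Finset.sum_le_sum fun i _ => Nat.lt_succ_iff.1 (σ i).2
    _ = n * N := by simp

/-- The projection onto the weight space at the level `j`. -/
noncomputable def levelProjection (N n j : ℕ) : Operator N n :=
  diagonal fun σ => if level σ = j then 1 else 0

theorem levelProjection_isHermitian (j : ℕ) : (levelProjection N n j).IsHermitian := by
  rw [levelProjection, isHermitian_diagonal_iff]
  intro k
  split_ifs <;> simp [IsSelfAdjoint]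

theorem levelProjection_mul_self (j : ℕ) :
    levelProjection N n j * levelProjection N n j = levelProjection N n j := by
  rw [levelProjection, diagonal_mul_diagonal]
  simp

theorem sum_levelProjection : ∑ j ∈ Finset.range (n * N + 1), levelProjection N n j = 1 := by
  ext σ τ
  rw [Matrix.sum_apply]
  simp only [levelProjection, diagonal_apply, one_apply]
  split_ifs
  · rw [Finset.sum_ite_eq, if_pos (Finset.mem_range.2 (Nat.lt_succ_of_le (level_le σ)))]
  · simp

theorem totalThree_mul_levelProjection (j : ℕ) : total n (spinThree N) * levelProjection N n j =
    ((n * spin N - j : ℝ) : ℂ) • levelProjection N n j := by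
  rw [totalThree_eq_diagonal, levelProjection, diagonal_mul_diagonal, ← diagonal_smul]
  congr 1
  ext σ
  by_cases h : level σ = j
  · simp [h, totalWeight_eq]
  · simp [h]

theorem totalPlus_apply_eq_zero {σ τ : Fin n → Fin (N + 1)} (h : level τ ≠ level σ + 1) :
    total n (spinPlus N) σ τ = 0 := by
  have h1 := congrFun (congrFun (totalThree_mul_totalPlus (N := N) (n := n)) σ) τ
  rw [totalThree_eq_diagonal, Matrix.sub_apply, diagonal_mul, mul_diagonal, totalWeight_eq,
    totalWeight_eq] at h1
  have h2 : ((level τ : ℂ) - (level σ + 1)) * total n (spinPlus N) σ τ = 0 := by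
    push_cast at h1
    linear_combination h1
  refine (mul_eq_zero.1 h2).resolve_left fun h3 => h ?_
  exact_mod_cast sub_eq_zero.1 h3

theorem totalPlus_mul_levelProjection (j : ℕ) :
    total n (spinPlus N) * levelProjection N n (j + 1) =
      levelProjection N n j * total n (spinPlus N) := by
  ext σ τ
  rw [levelProjection, levelProjection, mul_diagonal, diagonal_mul]
  by_cases h : level τ = level σ + 1
  · rw [h]; simp [mul_comm]
  · simp [totalPlus_apply_eq_zero h]

theorem totalPlus_mul_levelProjection_zero :
    total n (spinPlus N) * levelProjection N n 0 = 0 := by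
  ext σ τ
  rw [levelProjection, mul_diagonal]
  by_cases h : level τ = level σ + 1
  · rw [h]; simp
  · simp [totalPlus_apply_eq_zero h]

theorem totalMinus_mul_totalPlus : total n (spinMinus N) * total n (spinPlus N) =
    casimir N n - total n (spinThree N) * total n (spinThree N) - total n (spinThree N) := by
  rw [spinPlus_eq, spinMinus_eq, map_add, map_sub, map_smul,
    lowering_mul_raising (totalOne_mul_totalTwo N n), casimir]

theorem totalPlus_mul_totalMinus : total n (spinPlus N) * total n (spinMinus N) =
    casimir N n - total n (spinThree N) * total n (spinThree N) + total n (spinThree N) := by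
  rw [spinPlus_eq, spinMinus_eq, map_add, map_sub, map_smul,
    raising_mul_lowering (totalOne_mul_totalTwo N n), casimir]

theorem totalOne_commute_casimir : Commute (total n (spinOne N)) (casimir N n) := by
  have h := casimir_commute (totalOne_mul_totalTwo N n) (totalThree_mul_totalOne N n)
  rwa [show casimir N n = _ from add_rotate _ _ _]

theorem totalTwo_commute_casimir : Commute (total n (spinTwo N)) (casimir N n) := by
  have h := casimir_commute (totalTwo_mul_totalThree N n) (totalOne_mul_totalTwo N n)
  rwa [show casimir N n = _ from (add_rotate _ _ _).symm.trans rfl] at *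

theorem totalPlus_commute_casimir : Commute (total n (spinPlus N)) (casimir N n) := by
  rw [spinPlus_eq, map_add, map_smul]
  exact totalOne_commute_casimir.add_left (totalTwo_commute_casimir.smul_left _)

theorem totalMinus_conjTranspose :
    (total n (spinMinus N))ᴴ = total n (spinPlus N) := by
  rw [spinPlus_eq, spinMinus_eq, map_add, map_sub, map_smul, conjTranspose_sub,
    conjTranspose_smul, totalOne_isHermitian.eq, totalTwo_isHermitian.eq]
  simp

section Multiplicity

variable {U : Operator N n} {b : (Fin n → Fin (N + 1)) → ℝ}

/-- The multiplicity of the joint eigenvalue of the square of the total spin, with eigenvalue `l`,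
and of its third component, at the level `j`. -/
noncomputable def multiplicity (U : Operator N n) (b : (Fin n → Fin (N + 1)) → ℝ) (l : ℝ)
    (j : ℕ) : ℝ :=
  (spectralProjection U b l * levelProjection N n j).trace.re

variable (hU : U ∈ unitaryGroup _ ℂ)
  (hb : casimir N n = U * diagonal (fun k => (b k : ℂ)) * Uᴴ) (l : ℝ)
include hU

theorem multiplicity_nonneg (j : ℕ) : 0 ≤ multiplicity U b l j :=
  trace_mul_re_nonneg (spectralProjection_isHermitian b l) (spectralProjection_mul_self hU b l)
    (levelProjection_isHermitian j) (levelProjection_mul_self j)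

/-- The multiplicity is at most the dimension of the weight space, which an exponential Chebyshev
bound with parameter x controls. -/
theorem multiplicity_le_exp (j : ℕ) (x : ℝ) :
    multiplicity U b l j ≤ Real.exp (n * eta N x - x * (n * spin N - j)) := by
  refine (trace_mul_re_le (spectralProjection_isHermitian b l)
    (spectralProjection_mul_self hU b l)
    (levelProjection_isHermitian j) (levelProjection_mul_self j)).trans ?_
  rw [levelProjection, trace_diagonal, Complex.re_sum, Real.exp_sub, ← sum_exp_mul_totalWeight,
    Finset.sum_div]
  refine Finset.sum_le_sum fun σ _ => ?_
  split_ifs with h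
  · rw [totalWeight_eq, h, Complex.one_re, div_self (Real.exp_pos _).ne']
  · simp only [Complex.zero_re]
    positivity

include hb

/-- T₋T₊ = C - T₃² - T₃, with C the Casimir operator, acts as a scalar on a joint eigenspace of C
and T₃. -/
theorem trace_lowering_raising (j : ℕ) :
    (spectralProjection U b l * (total n (spinMinus N) * total n (spinPlus N)) *
      levelProjection N n j).trace.re =
    (l - (n * spin N - j) ^ 2 - (n * spin N - j)) * multiplicity U b l j := by
  have h : spectralProjection U b l * (total n (spinMinus N) * total n (spinPlus N)) *
      levelProjection N n j = ((l - (n * spin N - j) ^ 2 - (n * spin N - j) : ℝ) : ℂ) •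
      (spectralProjection U b l * levelProjection N n j) := by
    rw [totalMinus_mul_totalPlus, mul_sub, mul_sub, hb, spectralProjection_mul hU, sub_mul,
      sub_mul, mul_assoc _ (_ * _), mul_assoc (total n (spinThree N)), mul_assoc _ (total _ _),
      totalThree_mul_levelProjection, mul_smul_comm, totalThree_mul_levelProjection]
    simp only [mul_smul_comm, smul_mul_assoc]
    push_cast
    module
  rw [h, trace_smul, smul_eq_mul, Complex.re_ofReal_mul, multiplicity]

theorem trace_raising_lowering (j : ℕ) :
    (spectralProjection U b l * (total n (spinPlus N) * total n (spinMinus N)) *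
      levelProjection N n j).trace.re =
    (l - (n * spin N - j) ^ 2 + (n * spin N - j)) * multiplicity U b l j := by
  have h : spectralProjection U b l * (total n (spinPlus N) * total n (spinMinus N)) *
      levelProjection N n j = ((l - (n * spin N - j) ^ 2 + (n * spin N - j) : ℝ) : ℂ) •
      (spectralProjection U b l * levelProjection N n j) := by
    rw [totalPlus_mul_totalMinus, mul_add, mul_sub, hb, spectralProjection_mul hU, add_mul,
      sub_mul, mul_assoc _ (_ * _), mul_assoc (total n (spinThree N)), mul_assoc _ (total _ _),
      totalThree_mul_levelProjection, mul_smul_comm, totalThree_mul_levelProjection]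
    simp only [mul_smul_comm, smul_mul_assoc]
    push_cast
    module
  rw [h, trace_smul, smul_eq_mul, Complex.re_ofReal_mul, multiplicity]

omit hU hb in
theorem commute_spectralProjection_totalPlus (hU : U ∈ unitaryGroup _ ℂ)
    (hb : casimir N n = U * diagonal (fun k => (b k : ℂ)) * Uᴴ) :
    Commute (total n (spinPlus N)) (spectralProjection U b l) :=
  spectralProjection_commute hU b l (hb ▸ totalPlus_commute_casimir)

/-- Cyclicity of the trace moves T₊ from level j + 1 to level j, and the two scalars coincide since
μ² + μ = (μ + 1)² - (μ + 1). Unless this common factor vanishes, raising preserves the multiplicity.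
-/
theorem multiplicity_succ (j : ℕ) :
    (l - (n * spin N - (j + 1 : ℕ)) ^ 2 - (n * spin N - (j + 1 : ℕ))) *
        multiplicity U b l (j + 1) =
      (l - (n * spin N - (j + 1 : ℕ)) ^ 2 - (n * spin N - (j + 1 : ℕ))) *
        multiplicity U b l j := by
  rw [← trace_lowering_raising hU hb]
  have h := trace_raising_lowering hU hb l j
  have hc := (commute_spectralProjection_totalPlus l hU hb).eq
  have e : (spectralProjection U b l * (total n (spinMinus N) * total n (spinPlus N)) *
      levelProjection N n (j + 1)).trace =
      (spectralProjection U b l * (total n (spinPlus N) * total n (spinMinus N)) *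
      levelProjection N n j).trace := by
    rw [mul_assoc, mul_assoc, totalPlus_mul_levelProjection, ← mul_assoc, ← mul_assoc,
      trace_mul_comm, ← mul_assoc, ← mul_assoc, hc]
    simp only [mul_assoc]
  rw [e, h]
  push_cast
  ring

theorem multiplicity_zero : (l - (n * spin N) ^ 2 - n * spin N) * multiplicity U b l 0 = 0 := by
  have h := trace_lowering_raising hU hb l 0
  rw [mul_assoc, mul_assoc, totalPlus_mul_levelProjection_zero, mul_zero, mul_zero, trace_zero,
    Complex.zero_re] at h
  simpa using h.symm

open scoped ComplexOrder in
-- The trace is the squared Hilbert-Schmidt norm of E T₋ P. At a highest weight μ, where l = μ(μ +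
-- 1), the scalar is 2μ, which forces μ ≥ 0.
theorem multiplicity_mul_nonneg (j : ℕ) :
    0 ≤ (l - (n * spin N - j) ^ 2 + (n * spin N - j)) * multiplicity U b l j := by
  rw [← trace_raising_lowering hU hb]
  set E := spectralProjection U b l with hE
  set P := levelProjection N n j with hP
  set B := total n (spinMinus N) with hB
  set A := total n (spinPlus N) with hA
  have hc : A * E = E * A := (commute_spectralProjection_totalPlus l hU hb).eq
  have hEE : E * E = E := spectralProjection_mul_self hU b l
  have hPP : P * P = P := levelProjection_mul_self j
  have hBA : Bᴴ = A := totalMinus_conjTranspose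
  have e : (E * (A * B) * P).trace = ((E * B * P)ᴴ * (E * B * P)).trace := by
    rw [conjTranspose_mul, conjTranspose_mul, (levelProjection_isHermitian j).eq, hBA,
      (spectralProjection_isHermitian b l).eq]
    calc (E * (A * B) * P).trace = (E * (A * B) * P * P).trace := by
          rw [mul_assoc _ P, hPP]
      _ = (P * (E * A) * B * P).trace := by rw [trace_mul_comm]; simp only [mul_assoc]
      _ = (P * (A * (E * E)) * B * P).trace := by rw [← hc, hEE]
      _ = _ := by rw [← hE, ← hP]; simp only [mul_assoc]
  rw [e]
  exact (Complex.le_def.1 (posSemidef_conjTranspose_mul_self (E * B * P)).trace_nonneg).1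

/-- Each weight space of an isotypic component is at most as large as the space of its vectors of
highest weight. -/
theorem exists_highest_weight {j : ℕ} (hj : multiplicity U b l j ≠ 0) :
    ∃ i ≤ j, 0 ≤ n * spin N - i ∧ l = (n * spin N - i) * (n * spin N - i + 1) ∧
      multiplicity U b l j = multiplicity U b l i := by
  suffices h : ∃ i ≤ j, l = (n * spin N - i) * (n * spin N - i + 1) ∧
      multiplicity U b l j = multiplicity U b l i by
    obtain ⟨i, hij, hl, hm⟩ := h
    refine ⟨i, hij, ?_, hl, hm⟩
    have hpos : 0 < multiplicity U b l i :=
      lt_of_le_of_ne (multiplicity_nonneg hU l i) (by rw [← hm]; exact hj.symm)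
    have h := nonneg_of_mul_nonneg_left (multiplicity_mul_nonneg hU hb l i) hpos
    rw [hl] at h
    linarith
  induction j with
  | zero =>
    refine ⟨0, le_rfl, ?_, rfl⟩
    have h := (mul_eq_zero.1 (multiplicity_zero hU hb l)).resolve_right hj
    simp only [Nat.cast_zero]
    linarith
  | succ j ih =>
    -- Either the factor vanishes, so that this level is itself the highest weight, or the
    -- multiplicity is that of the level above.
    by_cases hl : l - (n * spin N - (j + 1 : ℕ)) ^ 2 - (n * spin N - (j + 1 : ℕ)) = 0
    · exact ⟨j + 1, le_rfl, by linarith, rfl⟩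
    · have hm := mul_left_cancel₀ hl (multiplicity_succ hU hb l j)
      obtain ⟨i, hij, hl, hmi⟩ := ih (by rwa [← hm])
      exact ⟨i, hij.trans (Nat.le_succ j), hl, hm.trans hmi⟩

omit l in
/-- Traces of functions of the square of the total spin are bounded in terms of `η`. -/
theorem sum_exp_casimir_le (F : ℝ → ℝ) {B : ℝ} (hB : 0 ≤ B)
    (h : ∀ M : ℝ, 0 ≤ M → M ≤ n * spin N →
      ∃ x, Real.exp (F (M * (M + 1)) + (n * eta N x - x * M)) ≤ B) :
    ∑ k, Real.exp (F (b k)) ≤ (n * N + 1 : ℕ) ^ 2 * B := by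
  have hterm : ∀ l j, Real.exp (F l) * multiplicity U b l j ≤ B := by
    intro l j
    by_cases hj : multiplicity U b l j = 0
    · rwa [hj, mul_zero]
    -- The Chebyshev bound at level j itself would be too weak, since weight spaces near weight 0
    -- are large for every l. It is applied at the highest weight M, where l = M(M + 1).
    · obtain ⟨i, -, hi, hl, hm⟩ := exists_highest_weight hU hb l hj
      obtain ⟨x, hx⟩ := h _ hi (by linarith [(Nat.cast_nonneg i : (0 : ℝ) ≤ i)])
      refine le_trans ?_ hx
      rw [← hl, hm, Real.exp_add]
      exact mul_le_mul_of_nonneg_left (multiplicity_le_exp hU l i x) (Real.exp_pos _).le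
  have hcard : ∀ l, ((Finset.univ.filter fun k => b k = l).card : ℝ) =
      ∑ j ∈ Finset.range (n * N + 1), multiplicity U b l j := by
    intro l
    rw [← trace_spectralProjection hU, ← mul_one (spectralProjection U b l),
      ← sum_levelProjection, Finset.mul_sum, trace_sum, Complex.re_sum]
    rfl
  -- The Casimir operator has at most nN + 1 distinct eigenvalues, one for each possible level of a
  -- highest weight. Together with the number of levels this gives the polynomial prefactor.
  have hsub : Finset.univ.image b ⊆ (Finset.range (n * N + 1)).image
      fun i : ℕ => (n * spin N - i) * (n * spin N - i + 1) := by
    intro l hl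
    obtain ⟨k, -, hk⟩ := Finset.mem_image.1 hl
    have hpos : (0 : ℝ) < (Finset.univ.filter fun k => b k = l).card := by
      exact_mod_cast Finset.card_pos.2 ⟨k, by simp [hk]⟩
    rw [hcard] at hpos
    obtain ⟨j, hj, hj0⟩ := Finset.exists_ne_zero_of_sum_ne_zero hpos.ne'
    obtain ⟨i, hij, -, hl, -⟩ := exists_highest_weight hU hb l hj0
    exact Finset.mem_image.2 ⟨i, Finset.mem_range.2
      (hij.trans_lt (Finset.mem_range.1 hj)), hl.symm⟩
  have himage : ((Finset.univ.image b).card : ℝ) ≤ (n * N + 1 : ℕ) := by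
    exact_mod_cast (Finset.card_le_card hsub).trans
      (Finset.card_image_le.trans (Finset.card_range _).le)
  calc ∑ k, Real.exp (F (b k))
      = ∑ l ∈ Finset.univ.image b, (Finset.univ.filter fun k => b k = l).card • Real.exp (F l) :=
        Finset.sum_comp (fun l => Real.exp (F l)) b
    _ = ∑ l ∈ Finset.univ.image b, ∑ j ∈ Finset.range (n * N + 1),
          Real.exp (F l) * multiplicity U b l j := by
        refine Finset.sum_congr rfl fun l _ => ?_
        rw [nsmul_eq_mul, hcard, ← Finset.mul_sum, mul_comm]
    _ ≤ ∑ l ∈ Finset.univ.image b, ∑ j ∈ Finset.range (n * N + 1), B :=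
        Finset.sum_le_sum fun l _ => Finset.sum_le_sum fun j _ => hterm l j
    _ = (Finset.univ.image b).card * ((n * N + 1 : ℕ) * B) := by
        simp only [Finset.sum_const, Finset.card_range, nsmul_eq_mul]
    _ ≤ (n * N + 1 : ℕ) * ((n * N + 1 : ℕ) * B) := by gcongr
    _ = _ := by ring

end Multiplicity

end Casimir

/-! ### Concentration of the planar magnetisation -/

section Concentration

variable {N n : ℕ}

/-- The average `n⁻¹ ∑_i A_i` of the copies of a one-site operator. -/
noncomputable def average (n : ℕ) (A : Matrix (Fin (N + 1)) (Fin (N + 1)) ℂ) : Operator N n :=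
  (((n : ℝ)⁻¹ : ℝ) : ℂ) • total n A

theorem average_isHermitian {A : Matrix (Fin (N + 1)) (Fin (N + 1)) ℂ} (hA : A.IsHermitian) :
    (average n A).IsHermitian :=
  IsHermitian.ofReal_smul (total_isHermitian hA) _

open scoped Matrix.Norms.L2Operator in
theorem norm_average_le (A : Matrix (Fin (N + 1)) (Fin (N + 1)) ℂ) : ‖average n A‖ ≤ ‖A‖ := by
  rw [average, norm_smul, Complex.norm_real, Real.norm_of_nonneg (by positivity)]
  rcases Nat.eq_zero_or_pos n with rfl | hn
  · simp
  · refine (mul_le_mul_of_nonneg_left (norm_total_le A) (by positivity)).trans (le_of_eq ?_)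
    field_simp

/-- The deviation of the squared planar magnetisation density from `m ^ 2`. -/
noncomputable def planarDeviation (N n : ℕ) (m : ℝ) : Operator N n :=
  average n (spinOne N) * average n (spinOne N) + average n (spinTwo N) * average n (spinTwo N) -
    ((m ^ 2 : ℝ) : ℂ) • 1

theorem planarDeviation_isHermitian (m : ℝ) : (planarDeviation N n m).IsHermitian :=
  ((IsHermitian.mul_self (average_isHermitian (spinOne_isHermitian N))).add
    (IsHermitian.mul_self (average_isHermitian (spinTwo_isHermitian N)))).sub
    (IsHermitian.ofReal_smul isHermitian_one _)

theorem abs_totalWeight_le (σ : Fin n → Fin (N + 1)) : |totalWeight σ| ≤ n * spin N := by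
  rw [totalWeight_eq, abs_le]
  have h1 : ((level σ : ℕ) : ℝ) ≤ n * N := by exact_mod_cast level_le σ
  have h2 : (0 : ℝ) ≤ level σ := Nat.cast_nonneg _
  unfold spin
  constructor <;> linarith

/-- The exponent bounding the tilted collective Hamiltonian, as a function of an eigenvalue of the
square of the total spin. -/
noncomputable def tiltedExponent (n : ℕ) (β m t l : ℝ) : ℝ :=
  n * (β * (l / n ^ 2) + 2 * t * (l / n ^ 2 - m ^ 2) ^ 2)

/-- Functional calculus: the left-hand side is the tilted exponent evaluated at the Casimir
operator. -/
theorem tiltedExponent_conj {U : Operator N n} (hU : U ∈ unitaryGroup _ ℂ)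
    {b : (Fin n → Fin (N + 1)) → ℝ} (hb : casimir N n = U * diagonal (fun k => (b k : ℂ)) * Uᴴ)
    (β m t : ℝ) :
    U * diagonal (fun k => ((tiltedExponent n β m t (b k) : ℝ) : ℂ)) * Uᴴ =
      (n : ℂ) • ((β : ℂ) • ((n : ℂ) ^ 2)⁻¹ • casimir N n + (2 * t : ℂ) •
        ((((n : ℂ) ^ 2)⁻¹ • casimir N n - ((m ^ 2 : ℝ) : ℂ) • 1) *
        (((n : ℂ) ^ 2)⁻¹ • casimir N n - ((m ^ 2 : ℝ) : ℂ) • 1))) := by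
  have h1 : (1 : Operator N n) = unitaryConj hU 1 := (map_one _).symm
  rw [hb, ← unitaryConj_apply hU, ← unitaryConj_apply hU, h1]
  simp only [← map_smul, ← map_sub, ← map_mul, ← map_add]
  congr 1
  rw [← diagonal_one]
  simp only [← diagonal_smul, diagonal_sub, diagonal_mul_diagonal, diagonal_add]
  congr 1
  ext k
  simp only [tiltedExponent, Pi.smul_apply, smul_eq_mul]
  push_cast
  ring

open scoped ComplexOrder in
-- Put c = C/n², w = (T₃/n)² and a = c - m², so that R = a - w. The identity (a - w)² + (a + w)² =
-- 2a² + 2w² needs no commutativity. It leaves tn(a + w)² plus n(β(1 - Δ)w - 2tw²), and the latter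
-- is non-negative because w ≤ S². The room for the tilt thus comes from 1 - Δ.
theorem tilted_posSemidef {U : Operator N n} (hU : U ∈ unitaryGroup _ ℂ)
    {b : (Fin n → Fin (N + 1)) → ℝ} (hb : casimir N n = U * diagonal (fun k => (b k : ℂ)) * Uᴴ)
    (hn : 0 < n) {β Δ m t : ℝ} (ht : 0 ≤ t) (htS : 2 * t * spin N ^ 2 ≤ β * (1 - Δ)) :
    (U * diagonal (fun k => ((tiltedExponent n β m t (b k) : ℝ) : ℂ)) * Uᴴ -
      (collective N n β Δ + ((t * n : ℝ) : ℂ) •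
        (planarDeviation N n m * planarDeviation N n m))).PosSemidef := by
  have hn' : (n : ℂ) ≠ 0 := by exact_mod_cast hn.ne'
  have hnr : (n : ℝ) ≠ 0 := by exact_mod_cast hn.ne'
  rw [tiltedExponent_conj hU hb]
  set c : Operator N n := ((n : ℂ) ^ 2)⁻¹ • casimir N n with hc
  set w : Operator N n := average n (spinThree N) * average n (spinThree N) with hw
  set a : Operator N n := c - ((m ^ 2 : ℝ) : ℂ) • 1 with ha
  have hR : planarDeviation N n m = a - w := by
    simp only [planarDeviation, ha, hc, hw, casimir, average, smul_mul_assoc, mul_smul_comm]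
    push_cast
    simp only [pow_two]
    module
  have hcoll : collective N n β Δ = (n : ℂ) • ((β : ℂ) • c - ((β * (1 - Δ) : ℝ) : ℂ) • w) := by
    simp only [collective, hc, hw, casimir, average, smul_mul_assoc, mul_smul_comm, smul_smul,
      smul_add, smul_sub]
    push_cast
    have e1 : (n : ℂ) * (β * ((n : ℂ) ^ 2)⁻¹) = β / n := by field_simp
    have e2 : (n : ℂ) * (β * (1 - Δ) * ((n : ℂ)⁻¹ * (n : ℂ)⁻¹)) = β / n * (1 - Δ) := by field_simp
    rw [e1]
    simp only [mul_assoc] at e2 ⊢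
    rw [e2]
    module
  have haH : (a + w).IsHermitian := by
    refine (IsHermitian.sub ?_ (IsHermitian.ofReal_smul isHermitian_one _)).add
      (IsHermitian.mul_self (average_isHermitian (spinThree_isHermitian N)))
    rw [hc, show ((n : ℂ) ^ 2)⁻¹ = ((((n : ℝ) ^ 2)⁻¹ : ℝ) : ℂ) by push_cast; rfl]
    exact IsHermitian.ofReal_smul casimir_isHermitian _
  have hwd : w = diagonal fun σ => (((totalWeight σ / n) ^ 2 : ℝ) : ℂ) := by
    rw [hw, average, totalThree_eq_diagonal, ← diagonal_smul, diagonal_mul_diagonal]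
    congr 1
    ext σ
    simp only [Pi.smul_apply, smul_eq_mul]
    push_cast
    ring
  have hdiff : (n : ℂ) • ((β : ℂ) • c + (2 * t : ℂ) • (a * a)) -
      (collective N n β Δ + ((t * n : ℝ) : ℂ) • (planarDeviation N n m * planarDeviation N n m)) =
      (n : ℂ) • (((β * (1 - Δ) : ℝ) : ℂ) • w - (2 * t : ℂ) • (w * w)) +
      ((t * n : ℝ) : ℂ) • ((a + w)ᴴ * (a + w)) := by
    rw [hR, hcoll, haH.eq]
    simp only [sub_mul, mul_sub, add_mul, mul_add]
    push_cast
    module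
  rw [hdiff]
  refine PosSemidef.add ?_ ((posSemidef_conjTranspose_mul_self (a + w)).smul ?_)
  · rw [hwd, diagonal_mul_diagonal, ← diagonal_smul, ← diagonal_smul, diagonal_sub,
      ← diagonal_smul, posSemidef_diagonal_iff]
    intro σ
    have hμ : (totalWeight σ / n) ^ 2 ≤ spin N ^ 2 := by
      refine sq_le_sq' ?_ ?_
      · rw [le_div_iff₀ (by positivity)]
        linarith [(abs_le.1 (abs_totalWeight_le σ)).1]
      · rw [div_le_iff₀ (by positivity)]
        linarith [(abs_le.1 (abs_totalWeight_le σ)).2]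
    have hr : 0 ≤ (n : ℝ) * (β * (1 - Δ) * (totalWeight σ / n) ^ 2 -
        2 * t * ((totalWeight σ / n) ^ 2 * (totalWeight σ / n) ^ 2)) := by
      refine mul_nonneg (by positivity) ?_
      have h1 : 2 * t * (totalWeight σ / n) ^ 2 ≤ β * (1 - Δ) :=
        (mul_le_mul_of_nonneg_left hμ (by positivity)).trans htS
      nlinarith [mul_le_mul_of_nonneg_right h1 (sq_nonneg (totalWeight σ / n))]
    simp only [Pi.smul_apply, smul_eq_mul]
    exact_mod_cast hr
  · exact_mod_cast (by positivity : 0 ≤ t * n)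

/-- The bound on the tilted exponent that results from mean-field theory. -/
theorem exists_tilted_bound {β m t ε δ : ℝ} (hβ : 0 < β) (hm : m ∈ Set.Ico 0 (spin N))
    (hn : 0 < n) (ht : 0 ≤ t) (hε : 0 < ε)
    (hle : ∀ r, 0 ≤ r → r ≤ spin N → ∃ x, 0 ≤ x ∧
      eta N x - x * r + β * r ^ 2 ≤ eta N (2 * β * m) - β * m ^ 2)
    (hsep : ∀ r, 0 ≤ r → r ≤ spin N → ε ≤ |r ^ 2 - m ^ 2| →
      ∃ x, 0 ≤ x ∧ eta N x - x * r + β * r ^ 2 ≤ eta N (2 * β * m) - β * m ^ 2 - δ)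
    (htδ : 2 * t * spin N ^ 4 ≤ δ) {M : ℝ} (hM : 0 ≤ M) (hMS : M ≤ n * spin N) :
    ∃ x, tiltedExponent n β m t (M * (M + 1)) + (n * eta N x - x * M) ≤
      n * (eta N (2 * β * m) - β * m ^ 2) + n * (2 * t * ε ^ 2) +
        (β * spin N + 2 * t * (2 * spin N ^ 3 + spin N ^ 2)) := by
  have hn' : (0 : ℝ) < n := by exact_mod_cast hn
  have hn1 : (1 : ℝ) ≤ n := by exact_mod_cast hn
  obtain ⟨r, rfl⟩ : ∃ r, M = n * r := ⟨M / n, by field_simp⟩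
  have hr : 0 ≤ r := by
    by_contra! h
    nlinarith
  have hrS : r ≤ spin N := le_of_mul_le_mul_left hMS hn'
  have hS : 0 ≤ spin N := hr.trans hrS
  obtain ⟨hm0, hmS⟩ := hm
  set A := r ^ 2 - m ^ 2 with hA
  have hAS : |A| ≤ spin N ^ 2 := by
    rw [abs_le]
    constructor <;> nlinarith
  have hA2 : A ^ 2 ≤ spin N ^ 4 := by
    rw [← sq_abs]
    nlinarith [abs_nonneg A]
  have hred : ∀ x, tiltedExponent n β m t (n * r * (n * r + 1)) + (n * eta N x - x * (n * r)) ≤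
      n * (eta N x - x * r + β * r ^ 2) + n * (2 * t * A ^ 2) +
        (β * spin N + 2 * t * (2 * spin N ^ 3 + spin N ^ 2)) := by
    intro x
    -- The Casimir density at M = nr is r² + r/n, and the shift r/n contributes only terms bounded
    -- in n.
    have h1 : tiltedExponent n β m t (n * r * (n * r + 1)) =
        n * (β * r ^ 2) + β * r + 2 * t * (n * A ^ 2 + 2 * A * r + r ^ 2 / n) := by
      rw [tiltedExponent, hA]
      field_simp
      ring
    have h2 : n * A ^ 2 + 2 * A * r + r ^ 2 / n ≤
        n * A ^ 2 + (2 * spin N ^ 3 + spin N ^ 2) := by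
      have h3 : r ^ 2 / n ≤ spin N ^ 2 := by
        refine (div_le_self (sq_nonneg r) hn1).trans ?_
        nlinarith
      have h4 : A * r ≤ spin N ^ 3 := by
        calc A * r ≤ |A| * r := mul_le_mul_of_nonneg_right (le_abs_self A) hr
          _ ≤ spin N ^ 2 * spin N := mul_le_mul hAS hrS hr (sq_nonneg _)
          _ = spin N ^ 3 := by ring
      linarith
    have h5 := mul_le_mul_of_nonneg_left h2 (by positivity : 0 ≤ 2 * t)
    have h6 := mul_le_mul_of_nonneg_left hrS hβ.le
    rw [h1]
    nlinarith
  -- Away from the maximiser the tilt 2tA² is absorbed by the gap δ. Near it, the tilt is at most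
  -- 2tε².
  by_cases hAε : ε ≤ |A|
  · obtain ⟨x, -, hx⟩ := hsep r hr hrS hAε
    refine ⟨x, (hred x).trans ?_⟩
    have h1 : 2 * t * A ^ 2 ≤ δ :=
      (mul_le_mul_of_nonneg_left hA2 (by positivity)).trans htδ
    have h2 : 0 ≤ 2 * t * ε ^ 2 := by positivity
    have h3 : eta N x - x * r + β * r ^ 2 + 2 * t * A ^ 2 ≤
        eta N (2 * β * m) - β * m ^ 2 + 2 * t * ε ^ 2 := by linarith
    have := mul_le_mul_of_nonneg_left h3 hn'.le
    linarith
  · obtain ⟨x, -, hx⟩ := hle r hr hrS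
    refine ⟨x, (hred x).trans ?_⟩
    have h1 : A ^ 2 ≤ ε ^ 2 := by
      rw [← sq_abs]
      exact pow_le_pow_left₀ (abs_nonneg A) (not_le.1 hAε).le 2
    have h2 := mul_le_mul_of_nonneg_left h1 (by positivity : 0 ≤ 2 * t)
    have h3 : eta N x - x * r + β * r ^ 2 + 2 * t * A ^ 2 ≤
        eta N (2 * β * m) - β * m ^ 2 + 2 * t * ε ^ 2 := by linarith
    have := mul_le_mul_of_nonneg_left h3 hn'.le
    linarith

open scoped Matrix.Norms.L2Operator in
-- The Peierls-Bogoliubov inequality turns the comparison of the two partition functions into a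
-- bound on ⟨R²⟩. The leading term exp(ng) cancels, and the constant k appears twice because the
-- on-site terms are removed once from each partition function.
theorem mul_thermal_planarDeviation_sq_le {β Δ m t ε δ : ℝ} (hβ : 0 < β) (hΔ : -1 ≤ Δ)
    (hm : m ∈ Set.Ico 0 (spin N)) (hn : 0 < n) (ht : 0 ≤ t) (hε : 0 < ε)
    (hle : ∀ r, 0 ≤ r → r ≤ spin N → ∃ x, 0 ≤ x ∧
      eta N x - x * r + β * r ^ 2 ≤ eta N (2 * β * m) - β * m ^ 2)
    (hsep : ∀ r, 0 ≤ r → r ≤ spin N → ε ≤ |r ^ 2 - m ^ 2| →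
      ∃ x, 0 ≤ x ∧ eta N x - x * r + β * r ^ 2 ≤ eta N (2 * β * m) - β * m ^ 2 - δ)
    (htδ : 2 * t * spin N ^ 4 ≤ δ) (htS : 2 * t * spin N ^ 2 ≤ β * (1 - Δ)) :
    t * n * (thermal ((-(β : ℂ)) • heisenberg N n Δ)
      (planarDeviation N n m * planarDeviation N n m)).re ≤
      n * (2 * t * ε ^ 2) + 2 * Real.log (n * N + 1 : ℕ) +
        (2 * (β * ‖onSiteEnergy N Δ‖) + (β * spin N + 2 * t * (2 * spin N ^ 3 + spin N ^ 2))) := by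
  set K := (-(β : ℂ)) • heisenberg N n Δ with hK
  set R := planarDeviation N n m with hR
  set k := β * ‖onSiteEnergy N Δ‖ with hk
  set g := eta N (2 * β * m) - β * m ^ 2 with hg
  set c := β * spin N + 2 * t * (2 * spin N ^ 3 + spin N ^ 2) with hc
  have hKH : K.IsHermitian := neg_smul_heisenberg_isHermitian β Δ
  have hCH : (collective N n β Δ).IsHermitian := collective_isHermitian β Δ
  have hRH : (((t * n : ℝ) : ℂ) • (R * R)).IsHermitian :=
    IsHermitian.ofReal_smul (IsHermitian.mul_self (planarDeviation_isHermitian m)) _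
  have hnorm : ‖K - collective N n β Δ‖ ≤ k := norm_neg_smul_heisenberg_sub_le hβ Δ
  have hlow : Real.exp (n * g) ≤ Real.exp k * (NormedSpace.exp K).trace.re :=
    (exp_le_trace_exp_collective hβ hΔ hn m).trans
      (trace_exp_le_of_norm_sub_le hCH hKH (by rwa [norm_sub_rev]))
  have hjens := exp_thermal_mul_trace_exp_le hKH hRH
  have hup1 : (NormedSpace.exp (K + ((t * n : ℝ) : ℂ) • (R * R))).trace.re ≤ Real.exp k *
      (NormedSpace.exp (collective N n β Δ + ((t * n : ℝ) : ℂ) • (R * R))).trace.re :=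
    trace_exp_le_of_norm_sub_le (hKH.add hRH) (hCH.add hRH) (by rwa [add_sub_add_right_eq_sub])
  obtain ⟨U, hU, b, hb⟩ := exists_unitary_diagonal (casimir_isHermitian (N := N) (n := n))
  have hFH : (U * diagonal (fun k => ((tiltedExponent n β m t (b k) : ℝ) : ℂ)) * Uᴴ).IsHermitian :=
    isHermitian_mul_mul_conjTranspose U
      ((isHermitian_diagonal_iff).2 fun k => by simp [IsSelfAdjoint])
  have hup2 := trace_exp_le_of_posSemidef (hCH.add hRH) hFH
    (tilted_posSemidef (m := m) hU hb hn ht htS)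
  rw [trace_exp_unitary_diagonal hU, Complex.ofReal_re] at hup2
  have hup3 := sum_exp_casimir_le hU hb (tiltedExponent n β m t)
    (B := Real.exp (n * g + n * (2 * t * ε ^ 2) + c)) (Real.exp_pos _).le fun M hM hMS => by
      obtain ⟨x, hx⟩ := exists_tilted_bound hβ hm hn ht hε hle hsep htδ hM hMS
      exact ⟨x, Real.exp_le_exp.2 hx⟩
  have hre : (thermal K (((t * n : ℝ) : ℂ) • (R * R))).re = t * n * (thermal K (R * R)).re := by
    rw [map_smul, smul_eq_mul, Complex.re_ofReal_mul]
  rw [hre] at hjens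
  set ω := (thermal K (R * R)).re with hω
  have hpos : (0 : ℝ) < (n * N + 1 : ℕ) := by positivity
  have hfinal : Real.exp (t * n * ω) * Real.exp (n * g) ≤ Real.exp k * (Real.exp k *
      ((n * N + 1 : ℕ) ^ 2 * Real.exp (n * g + n * (2 * t * ε ^ 2) + c))) :=
    calc Real.exp (t * n * ω) * Real.exp (n * g)
        ≤ Real.exp (t * n * ω) * (Real.exp k * (NormedSpace.exp K).trace.re) := by gcongr
      _ = Real.exp k * (Real.exp (t * n * ω) * (NormedSpace.exp K).trace.re) := by ring
      _ ≤ Real.exp k * (Real.exp k * ((n * N + 1 : ℕ) ^ 2 *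
          Real.exp (n * g + n * (2 * t * ε ^ 2) + c))) := by
        refine mul_le_mul_of_nonneg_left ?_ (Real.exp_pos k).le
        refine hjens.trans (hup1.trans ?_)
        exact mul_le_mul_of_nonneg_left (hup2.trans hup3) (Real.exp_pos k).le
  rw [show ((n * N + 1 : ℕ) : ℝ) ^ 2 = Real.exp (2 * Real.log (n * N + 1 : ℕ)) by
      rw [two_mul, Real.exp_add, Real.exp_log hpos, sq],
    ← Real.exp_add, ← Real.exp_add, ← Real.exp_add, ← Real.exp_add, Real.exp_le_exp] at hfinal
  linarith

open scoped Matrix.Norms.L2Operator in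
/-- In the Gibbs state the squared planar magnetisation density concentrates at the square of the
maximiser of the mean-field functional. -/
theorem tendsto_thermal_planarDeviation_sq (hN : 1 ≤ N) {β Δ m : ℝ} (hβ : 0 < β) (hΔ : -1 ≤ Δ)
    (hΔ1 : Δ < 1) (hm : m ∈ Set.Ico 0 (spin N))
    (hle : ∀ r, 0 ≤ r → r ≤ spin N → ∃ x, 0 ≤ x ∧
      eta N x - x * r + β * r ^ 2 ≤ eta N (2 * β * m) - β * m ^ 2)
    (hsep : ∀ ε, 0 < ε → ∃ δ, 0 < δ ∧ ∀ r, 0 ≤ r → r ≤ spin N → ε ≤ |r ^ 2 - m ^ 2| →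
      ∃ x, 0 ≤ x ∧ eta N x - x * r + β * r ^ 2 ≤ eta N (2 * β * m) - β * m ^ 2 - δ) :
    Tendsto (fun n : ℕ => (thermal ((-(β : ℂ)) • heisenberg N n Δ)
      (planarDeviation N n m * planarDeviation N n m)).re) atTop (𝓝 0) := by
  have hnonneg : ∀ n : ℕ, 0 ≤ (thermal ((-(β : ℂ)) • heisenberg N n Δ)
      (planarDeviation N n m * planarDeviation N n m)).re := by
    intro n
    have h := norm_thermal_mul_sq_le (neg_smul_heisenberg_isHermitian (N := N) (n := n) β Δ) 1
      (planarDeviation N n m)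
    rw [(planarDeviation_isHermitian m).eq, norm_one, one_pow, one_mul, one_mul] at h
    exact (sq_nonneg _).trans h
  have hlog : Tendsto (fun n : ℕ => Real.log (n * N + 1 : ℕ) / n) atTop (𝓝 0) := by
    have hN0 : (N : ℝ) ≠ 0 := by exact_mod_cast (by omega : N ≠ 0)
    -- The coefficients are chosen so that the affine denominator evaluated at nN + 1 is n.
    have h := Real.tendsto_pow_log_div_mul_add_atTop ((N : ℝ)⁻¹) (-(N : ℝ)⁻¹) 1 (by positivity)
    have h2 : Tendsto (fun n : ℕ => ((n * N + 1 : ℕ) : ℝ)) atTop atTop := by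
      refine tendsto_natCast_atTop_atTop.comp (tendsto_atTop_mono (fun n => ?_) tendsto_id)
      simp only [id]
      nlinarith
    refine (h.comp h2).congr fun n => ?_
    simp only [Function.comp, pow_one]
    congr 1
    push_cast
    field_simp
    ring
  refine tendsto_order.2 ⟨fun a ha => Eventually.of_forall fun n => ha.trans_le (hnonneg n),
    fun a ha => ?_⟩
  obtain ⟨ε, hε, hεa⟩ : ∃ ε : ℝ, 0 < ε ∧ 2 * ε ^ 2 < a := by
    refine ⟨Real.sqrt (a / 4), Real.sqrt_pos.2 (by positivity), ?_⟩
    rw [Real.sq_sqrt (by positivity)]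
    linarith
  obtain ⟨δ, hδ, hsep⟩ := hsep ε hε
  have hS : 0 < spin N := hm.1.trans_lt hm.2
  have hΔ' : 0 < β * (1 - Δ) := mul_pos hβ (by linarith)
  -- The first bound lets δ absorb the tilt, and the second lets 1 - Δ absorb it. The minimum is
  -- positive because Δ < 1.
  set t := min (δ / (2 * spin N ^ 4)) (β * (1 - Δ) / (2 * spin N ^ 2)) with ht
  have htpos : 0 < t := lt_min (by positivity) (by positivity)
  have htδ : 2 * t * spin N ^ 4 ≤ δ := by
    have := min_le_left (δ / (2 * spin N ^ 4)) (β * (1 - Δ) / (2 * spin N ^ 2))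
    rw [← ht, le_div_iff₀ (by positivity)] at this
    linarith
  have htS : 2 * t * spin N ^ 2 ≤ β * (1 - Δ) := by
    have := min_le_right (δ / (2 * spin N ^ 4)) (β * (1 - Δ) / (2 * spin N ^ 2))
    rw [← ht, le_div_iff₀ (by positivity)] at this
    linarith
  set c := 2 * (β * ‖onSiteEnergy N Δ‖) + (β * spin N + 2 * t * (2 * spin N ^ 3 + spin N ^ 2))
    with hc
  have hlim : Tendsto (fun n : ℕ => 2 * ε ^ 2 + (2 / t) * (Real.log (n * N + 1 : ℕ) / n) +
      (c / t) * ((n : ℝ)⁻¹)) atTop (𝓝 (2 * ε ^ 2 + (2 / t) * 0 + (c / t) * 0)) :=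
    ((hlog.const_mul _).const_add _).add
      ((tendsto_inv_atTop_zero.comp tendsto_natCast_atTop_atTop).const_mul _)
  rw [mul_zero, mul_zero, add_zero, add_zero] at hlim
  filter_upwards [hlim.eventually_lt_const hεa, eventually_gt_atTop 0] with n hna hn
  refine lt_of_le_of_lt ?_ hna
  have h := mul_thermal_planarDeviation_sq_le hβ hΔ hm hn htpos.le hε hle hsep htδ htS
  rw [← hc] at h
  have hn' : (0 : ℝ) < n := by exact_mod_cast hn
  refine le_of_mul_le_mul_left (h.trans (le_of_eq ?_)) (mul_pos htpos hn')
  field_simp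

end Concentration

/-! ### Moments of the magnetisation -/

section Moments

variable {N n : ℕ}

theorem totalThree_commute_neg_smul_heisenberg (β Δ : ℝ) :
    Commute (total n (spinThree N)) ((-(β : ℂ)) • heisenberg N n Δ) := by
  rw [neg_smul_heisenberg]
  refine Commute.sub_right ?_ (Commute.smul_right ?_ _)
  · refine Commute.smul_right (Commute.add_right ?_ (Commute.smul_right ?_ _)) _
    · exact sum_sq_commute (totalThree_mul_totalOne N n) (totalTwo_mul_totalThree N n)
    · exact (Commute.refl _).mul_right (Commute.refl _)
  · have h : Commute (spinThree N) (onSiteEnergy N Δ) :=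
      (sum_sq_commute (spinThree_mul_spinOne N) (spinTwo_mul_spinThree N)).add_right
        (((Commute.refl _).mul_right (Commute.refl _)).smul_right _)
    refine sub_eq_zero.1 ?_
    rw [total_mul_total_sub, h.eq, sub_self, map_zero]

theorem totalThree_mul_averageOne :
    total n (spinThree N) * average n (spinOne N) - average n (spinOne N) * total n (spinThree N) =
      Complex.I • average n (spinTwo N) := by
  rw [average, average, mul_smul_comm, smul_mul_assoc, ← smul_sub, totalThree_mul_totalOne,
    smul_comm]

theorem totalThree_mul_averageTwo :
    total n (spinThree N) * average n (spinTwo N) - average n (spinTwo N) * total n (spinThree N) =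
      -(Complex.I • average n (spinOne N)) := by
  rw [average, average, mul_smul_comm, smul_mul_assoc, ← smul_sub, ← neg_sub,
    totalTwo_mul_totalThree, smul_neg, smul_comm]

theorem averageTwo_mul_averageOne :
    average n (spinTwo N) * average n (spinOne N) = average n (spinOne N) * average n (spinTwo N) -
      ((n : ℂ)⁻¹ * Complex.I) • average n (spinThree N) := by
  have h : average n (spinOne N) * average n (spinTwo N) -
      average n (spinTwo N) * average n (spinOne N) =
      ((n : ℂ)⁻¹ * Complex.I) • average n (spinThree N) := by
    simp only [average, mul_smul_comm, smul_mul_assoc]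
    rw [← smul_sub, ← smul_sub, totalOne_mul_totalTwo]
    simp only [smul_smul]
    push_cast
    congr 1
    ring
  rw [← h, sub_sub_cancel]

open scoped Matrix.Norms.L2Operator in
/-- Up to an error of order `1 / n`, the third component of the total spin generates the rotations
of the powers of the magnetisation as if its components commuted. -/
theorem exists_totalThree_commutator_pow (N p : ℕ) : ∃ c : ℝ, ∀ n : ℕ, ∃ E : Operator N n,
    ‖E‖ ≤ c * (n : ℝ)⁻¹ ∧
    total n (spinThree N) * average n (spinOne N) ^ (p + 1) -
      average n (spinOne N) ^ (p + 1) * total n (spinThree N) =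
      (Complex.I * (p + 1)) • (average n (spinOne N) ^ p * average n (spinTwo N)) + E := by
  induction p with
  | zero =>
    refine ⟨0, fun n => ⟨0, by simp, ?_⟩⟩
    simp [totalThree_mul_averageOne]
  | succ p ih =>
    obtain ⟨c, hc⟩ := ih
    refine ⟨c * ‖spinOne N‖ + (p + 1) * (‖spinOne N‖ ^ p * ‖spinThree N‖), fun n => ?_⟩
    obtain ⟨E, hE, h⟩ := hc n
    set x := average n (spinOne N) with hx
    set y := average n (spinTwo N) with hy
    set z := average n (spinThree N) with hz
    set T := total n (spinThree N) with hT
    refine ⟨E * x + ((p + 1) * (n : ℂ)⁻¹) • (x ^ p * z), ?_, ?_⟩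
    · have h1 : ‖E * x‖ ≤ c * (n : ℝ)⁻¹ * ‖spinOne N‖ :=
        (norm_mul_le _ _).trans (mul_le_mul hE (norm_average_le _) (norm_nonneg _)
          ((norm_nonneg _).trans hE))
      have h2 : ‖x ^ p * z‖ ≤ ‖spinOne N‖ ^ p * ‖spinThree N‖ := by
        refine (norm_mul_le _ _).trans (mul_le_mul ?_ (norm_average_le _) (norm_nonneg _)
          (by positivity))
        exact (norm_pow_le x p).trans (pow_le_pow_left₀ (norm_nonneg _) (norm_average_le _) p)
      have h3 : ‖((p + 1) * (n : ℂ)⁻¹ : ℂ)‖ = (p + 1) * (n : ℝ)⁻¹ := by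
        rw [norm_mul, norm_inv, Complex.norm_natCast]
        norm_cast
      refine (norm_add_le _ _).trans ?_
      rw [norm_smul, h3]
      have h4 := mul_le_mul_of_nonneg_left h2 (by positivity : 0 ≤ ((p : ℝ) + 1) * (n : ℝ)⁻¹)
      linarith
    · have e : T * x ^ (p + 1 + 1) - x ^ (p + 1 + 1) * T =
          (T * x ^ (p + 1) - x ^ (p + 1) * T) * x + x ^ (p + 1) * (T * x - x * T) := by
        rw [pow_succ x (p + 1)]
        noncomm_ring
      -- Moving y to the right past x is the only reordering, and it costs one factor 1/n at each
      -- induction step.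
      have hyx : y * x = x * y - ((n : ℂ)⁻¹ * Complex.I) • z := averageTwo_mul_averageOne
      rw [e, h, totalThree_mul_averageOne, ← hy, add_mul, smul_mul_assoc, mul_assoc (x ^ p), hyx,
        mul_sub, ← mul_assoc (x ^ p) x y, ← pow_succ, mul_smul_comm, mul_smul_comm, smul_sub,
        smul_smul]
      have hI : Complex.I * (p + 1) * ((n : ℂ)⁻¹ * Complex.I) = -((p + 1) * (n : ℂ)⁻¹) := by
        linear_combination ((p + 1) * (n : ℂ)⁻¹) * Complex.I_mul_I
      rw [hI]
      push_cast
      module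

/-- The moments of `m cos θ` for a uniformly distributed angle `θ`. -/
noncomputable def circleMoment (m : ℝ) : ℕ → ℂ
  | 0 => 1
  | 1 => 0
  | p + 2 => (p + 1) / (p + 2) * (m : ℂ) ^ 2 * circleMoment m p

theorem circleMoment_odd (m : ℝ) (j : ℕ) : circleMoment m (2 * j + 1) = 0 := by
  induction j with
  | zero => rfl
  | succ j ih => rw [show 2 * (j + 1) + 1 = (2 * j + 1) + 2 by ring, circleMoment, ih, mul_zero]

theorem circleMoment_even (m : ℝ) (j : ℕ) :
    (((2 * j).factorial : ℕ) : ℂ)⁻¹ * circleMoment m (2 * j) =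
      1 / ((j.factorial : ℂ) ^ 2) * ((m : ℂ) / 2) ^ (2 * j) := by
  induction j with
  | zero => simp [circleMoment]
  | succ j ih =>
    have h1 : ((j : ℂ) + 1) ≠ 0 := by exact_mod_cast Nat.succ_ne_zero j
    have h2 : (2 * (j : ℂ) + 1) ≠ 0 := by exact_mod_cast Nat.succ_ne_zero (2 * j)
    have h3 : (2 * (j : ℂ) + 2) ≠ 0 := by exact_mod_cast Nat.succ_ne_zero (2 * j + 1)
    have e : (((2 * (j + 1)).factorial : ℕ) : ℂ)⁻¹ * circleMoment m (2 * (j + 1)) =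
        ((m : ℂ) / 2) ^ 2 / (j + 1) ^ 2 *
          ((((2 * j).factorial : ℕ) : ℂ)⁻¹ * circleMoment m (2 * j)) := by
      rw [show 2 * (j + 1) = 2 * j + 2 by ring, circleMoment, Nat.factorial_succ,
        Nat.factorial_succ]
      push_cast
      have h3' : (2 * (j : ℂ) + 1 + 1) ≠ 0 := by convert h3 using 1; ring
      have hf : (((2 * j).factorial : ℕ) : ℂ) ≠ 0 := by exact_mod_cast Nat.factorial_ne_zero _
      field_simp
      ring
    rw [e, ih, Nat.factorial_succ]
    push_cast
    have hf : ((j.factorial : ℕ) : ℂ) ≠ 0 := by exact_mod_cast Nat.factorial_ne_zero _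
    field_simp
    ring

/-- The odd moments vanish. The even ones are m^(2j) (2j)! / (4^j (j!)²), which turns the
exponential series into the Bessel series. -/
theorem tsum_circleMoment (m : ℝ) (h : ℂ) :
    ∑' p : ℕ, ((p.factorial : ℕ) : ℂ)⁻¹ * h ^ p * circleMoment m p = besselI0 (h * m) := by
  have hinj : Function.Injective fun j : ℕ => 2 * j := fun a b hab => by simpa using hab
  have hsupp : Function.support (fun p : ℕ => ((p.factorial : ℕ) : ℂ)⁻¹ * h ^ p * circleMoment m p)
      ⊆ Set.range fun j : ℕ => 2 * j := by
    intro p hp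
    rcases Nat.even_or_odd' p with ⟨j, rfl | rfl⟩
    · exact ⟨j, rfl⟩
    · exact absurd (by simp [circleMoment_odd]) hp
  rw [← hinj.tsum_eq hsupp, besselI0]
  refine tsum_congr fun j => ?_
  rw [mul_right_comm, circleMoment_even, mul_assoc, ← mul_pow]
  congr 2
  ring

open scoped Matrix.Norms.L2Operator in
-- Rotation invariance in infinitesimal form, ⟨[T₃, A]⟩ = 0, is applied to A = y for the first
-- moment and to A = x^(p+1) y for the recursion.
theorem tendsto_thermal_average_pow {β Δ m : ℝ}
    (hconc : Tendsto (fun n : ℕ => (thermal ((-(β : ℂ)) • heisenberg N n Δ)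
      (planarDeviation N n m * planarDeviation N n m)).re) atTop (𝓝 0)) (p : ℕ) :
    Tendsto (fun n : ℕ => thermal ((-(β : ℂ)) • heisenberg N n Δ) (average n (spinOne N) ^ p))
      atTop (𝓝 (circleMoment m p)) := by
  have hK : ∀ n, ((-(β : ℂ)) • heisenberg N n Δ).IsHermitian :=
    fun n => neg_smul_heisenberg_isHermitian β Δ
  have hcomm : ∀ n (A : Operator N n), thermal ((-(β : ℂ)) • heisenberg N n Δ)
      (total n (spinThree N) * A - A * total n (spinThree N)) = 0 := by
    intro n A
    rw [map_sub, thermal_mul_comm (totalThree_commute_neg_smul_heisenberg β Δ), sub_self]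
  induction p using Nat.twoStepInduction with
  | zero =>
    simp only [pow_zero, circleMoment, thermal_one (hK _)]
    exact tendsto_const_nhds
  | one =>
    refine tendsto_const_nhds.congr fun n => ?_
    have h := hcomm n (average n (spinTwo N))
    rw [totalThree_mul_averageTwo, map_neg, map_smul, smul_eq_mul, neg_eq_zero, mul_eq_zero] at h
    rw [pow_one, h.resolve_left Complex.I_ne_zero, circleMoment]
  | more p ih _ =>
    obtain ⟨c, hc⟩ := exists_totalThree_commutator_pow N p
    choose E hE hEq using hc
    -- By the Cauchy-Schwarz inequality |⟨x^p R⟩|² is at most ‖x^p‖² ⟨R²⟩, with ‖x^p‖ bounded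
    -- uniformly in n.
    have hdev : Tendsto (fun n : ℕ => thermal ((-(β : ℂ)) • heisenberg N n Δ)
        (average n (spinOne N) ^ p * planarDeviation N n m)) atTop (𝓝 0) := by
      have hsq : Tendsto (fun n : ℕ => (‖spinOne N‖ ^ p) ^ 2 *
          (thermal ((-(β : ℂ)) • heisenberg N n Δ)
            (planarDeviation N n m * planarDeviation N n m)).re) atTop (𝓝 0) := by
        simpa using hconc.const_mul ((‖spinOne N‖ ^ p) ^ 2)
      have hsqrt := hsq.sqrt
      rw [Real.sqrt_zero] at hsqrt
      refine squeeze_zero_norm (fun n => ?_) hsqrt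
      have h := norm_thermal_mul_sq_le (hK n) (average n (spinOne N) ^ p) (planarDeviation N n m)
      rw [(planarDeviation_isHermitian m).eq] at h
      have hb : ‖average n (spinOne N) ^ p‖ ≤ ‖spinOne N‖ ^ p :=
        (norm_pow_le _ p).trans (pow_le_pow_left₀ (norm_nonneg _) (norm_average_le _) p)
      have hpos : 0 ≤ (thermal ((-(β : ℂ)) • heisenberg N n Δ)
          (planarDeviation N n m * planarDeviation N n m)).re := by
        have h1 := norm_thermal_mul_sq_le (hK n) 1 (planarDeviation N n m)
        rw [(planarDeviation_isHermitian m).eq, norm_one, one_pow, one_mul, one_mul] at h1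
        exact (sq_nonneg _).trans h1
      refine Real.le_sqrt_of_sq_le (h.trans ?_)
      gcongr
    have herr : Tendsto (fun n : ℕ => thermal ((-(β : ℂ)) • heisenberg N n Δ)
        (E n * average n (spinTwo N))) atTop (𝓝 0) := by
      have hlim : Tendsto (fun n : ℕ => c * (n : ℝ)⁻¹ * ‖spinTwo N‖) atTop (𝓝 0) := by
        simpa using ((tendsto_inv_atTop_zero.comp tendsto_natCast_atTop_atTop).const_mul
          c).mul_const ‖spinTwo N‖
      refine squeeze_zero_norm (fun n => ?_) hlim
      refine (norm_thermal_le (hK n) _).trans ((norm_mul_le _ _).trans ?_)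
      exact mul_le_mul (hE n) (norm_average_le _) (norm_nonneg _) ((norm_nonneg _).trans (hE n))
    have hrec : ∀ n : ℕ, thermal ((-(β : ℂ)) • heisenberg N n Δ)
        (average n (spinOne N) ^ (p + 2)) =
        (p + 1) / (p + 2) * (m : ℂ) ^ 2 *
          thermal ((-(β : ℂ)) • heisenberg N n Δ) (average n (spinOne N) ^ p) +
        (p + 1) / (p + 2) * thermal ((-(β : ℂ)) • heisenberg N n Δ)
          (average n (spinOne N) ^ p * planarDeviation N n m) +
        -Complex.I / (p + 2) * thermal ((-(β : ℂ)) • heisenberg N n Δ)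
          (E n * average n (spinTwo N)) := by
      intro n
      have h := hcomm n (average n (spinOne N) ^ (p + 1) * average n (spinTwo N))
      have hEqn := hEq n
      have htwo := totalThree_mul_averageTwo (N := N) (n := n)
      have hR : planarDeviation N n m = average n (spinOne N) * average n (spinOne N) +
        average n (spinTwo N) * average n (spinTwo N) - ((m ^ 2 : ℝ) : ℂ) • 1 := rfl
      set x := average n (spinOne N) with hx
      set y := average n (spinTwo N) with hy
      set T := total n (spinThree N) with hT
      set ω := thermal ((-(β : ℂ)) • heisenberg N n Δ) with hω
      -- The commutator is i(p + 1)x^p y² - i x^(p+2) + Ey, and y² is eliminated through R.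
      -- Collecting the two x^(p+2) terms produces the divisor p + 2.
      have e : T * (x ^ (p + 1) * y) - x ^ (p + 1) * y * T =
          (Complex.I * (p + 1)) • (x ^ p * planarDeviation N n m + ((m : ℂ) ^ 2) • x ^ p -
            x ^ (p + 2)) + E n * y - Complex.I • x ^ (p + 2) := by
        have e1 : T * (x ^ (p + 1) * y) - x ^ (p + 1) * y * T =
          (T * x ^ (p + 1) - x ^ (p + 1) * T) * y + x ^ (p + 1) * (T * y - y * T) := by
          noncomm_ring
        have e2 : x ^ p * planarDeviation N n m = x ^ (p + 2) + x ^ p * y * y -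
            ((m : ℂ) ^ 2) • x ^ p := by
          rw [hR, mul_sub, mul_add, mul_smul_comm, mul_one, ← mul_assoc, ← mul_assoc, ← pow_succ,
            ← pow_succ]
          push_cast
          rfl
        rw [e1, hEqn, htwo, e2, mul_neg, mul_smul_comm, ← pow_succ, add_mul, smul_mul_assoc]
        module
      rw [e] at h
      simp only [map_sub, map_add, map_smul, smul_eq_mul] at h
      have hp : ((p : ℂ) + 2) ≠ 0 := by exact_mod_cast Nat.succ_ne_zero (p + 1)
      field_simp
      linear_combination Complex.I * h + ((p + 1) * (ω (x ^ (p + 2)) - (m : ℂ) ^ 2 * ω (x ^ p)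
        - ω (x ^ p * planarDeviation N n m)) + ω (x ^ (p + 2))) * Complex.I_mul_I
    have hlim := ((ih.const_mul ((p + 1) / (p + 2) * (m : ℂ) ^ 2)).add
      (hdev.const_mul (((p : ℂ) + 1) / (p + 2)))).add
      (herr.const_mul (-Complex.I / ((p : ℂ) + 2)))
    rw [mul_zero, mul_zero, add_zero, add_zero] at hlim
    exact hlim.congr fun n => (hrec n).symm

/-! ### Convergence of the moment generating function. -/

open scoped Matrix.Norms.L2Operator in
theorem gibbs_expMagnetisation (β Δ : ℝ) (h : ℂ) :
    gibbs N n β Δ (expMagnetisation N n h) = ∑' p : ℕ, ((p.factorial : ℕ) : ℂ)⁻¹ * h ^ p *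
      thermal ((-(β : ℂ)) • heisenberg N n Δ) (average n (spinOne N) ^ p) := by
  have hexp : expMagnetisation N n h = NormedSpace.exp (h • average n (spinOne N)) := by
    rw [expMagnetisation, average, ← total_apply, smul_smul]
    push_cast
    rfl
  have hsum := NormedSpace.exp_series_hasSum_exp' (𝕂 := ℂ) (h • average n (spinOne N))
  have hcont : Continuous (thermal ((-(β : ℂ)) • heisenberg N n Δ)) :=
    LinearMap.continuous_of_finiteDimensional _
  have hmap := hsum.map (thermal ((-(β : ℂ)) • heisenberg N n Δ)) hcont
  rw [show gibbs N n β Δ (expMagnetisation N n h) =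
    thermal ((-(β : ℂ)) • heisenberg N n Δ) (expMagnetisation N n h) from rfl, hexp,
    ← hmap.tsum_eq]
  refine tsum_congr fun p => ?_
  rw [Function.comp, smul_pow, map_smul, map_smul, smul_eq_mul, smul_eq_mul, mul_assoc]

open scoped Matrix.Norms.L2Operator in
theorem tendsto_gibbs_expMagnetisation {β Δ m : ℝ}
    (hconc : Tendsto (fun n : ℕ => (thermal ((-(β : ℂ)) • heisenberg N n Δ)
      (planarDeviation N n m * planarDeviation N n m)).re) atTop (𝓝 0)) (h : ℂ) :
    Tendsto (fun n : ℕ => gibbs N n β Δ (expMagnetisation N n h)) atTop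
      (𝓝 (besselI0 (h * (m : ℂ)))) := by
  simp only [gibbs_expMagnetisation]
  rw [← tsum_circleMoment]
  -- The domination rests on ‖x‖ ≤ ‖S⁽¹⁾‖ for every n, so the terms of an exponential series bound
  -- all the summands.
  refine tendsto_tsum_of_dominated_convergence
    (bound := fun p : ℕ => (‖h‖ * ‖spinOne N‖) ^ p / p.factorial)
    (Real.summable_pow_div_factorial _)
    (fun p => (tendsto_thermal_average_pow hconc p).const_mul _)
    (Eventually.of_forall fun n p => ?_)
  rw [norm_mul, norm_mul, norm_inv, norm_pow, Complex.norm_natCast, mul_pow, div_eq_inv_mul,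
    mul_assoc]
  have hb : ‖thermal ((-(β : ℂ)) • heisenberg N n Δ) (average n (spinOne N) ^ p)‖ ≤
      ‖spinOne N‖ ^ p :=
    (norm_thermal_le (neg_smul_heisenberg_isHermitian β Δ) _).trans
      ((norm_pow_le _ p).trans (pow_le_pow_left₀ (norm_nonneg _) (norm_average_le _) p))
  gcongr

end Moments

end SpinModel

theorem theorem2p2 (N : ℕ) (hN : 1 ≤ N) (β : ℝ) (hβ : 0 < β) :
    ∃ m : ℝ, SpinModel.IsMaximiser N β m ∧
      ∀ Δ : ℝ, -1 ≤ Δ → Δ < 1 → ∀ h : ℂ,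
        Tendsto
          (fun n : ℕ => SpinModel.gibbs N n β Δ (SpinModel.expMagnetisation N n h))
          atTop (𝓝 (SpinModel.besselI0 (h * (m : ℂ)))) := by
  obtain ⟨m, hm, hle, hsep⟩ := SpinModel.exists_isMaximiser hN hβ
  exact ⟨m, hm, fun Δ hΔ hΔ1 h => SpinModel.tendsto_gibbs_expMagnetisation
    (SpinModel.tendsto_thermal_planarDeviation_sq hN hβ hΔ hΔ1 hm.1 hle hsep) h⟩
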